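/- Setting. Let $n\ge 1$ and $k\ge 0$ be integers and consider a stationary memoryless channel. An $(n,k,P_\tau,\varepsilon)$-VLSF code for it consists of a common-randomness variable $U$; an encoder $f$ mapping $U$ and a message $W$, which is uniform on a set of $2^k$ elements and independent of $U$, to an infinite sequence of channel inputs; decoders $g_t$ that output a message on the basis of $U$ and of the channel outputs $Y^{nt}$ in the first $t$ frames of $n$ channel uses; and a nonnegative-integer-valued random variable $\tau$ with distribution $P_\tau$ such that, for each $t$, the event $\{\tau\le t\}$ is determined by $(U,Y^{nt})$, and such that $\mathbb P[g_\tau(U,Y^{n\tau})\ne W]\le\varepsilon$. Frame-synchronous queue. In each channel use one packet arrives with probability $\lambda>0$, independently across channel uses. Time is divided into frames of $n$ channel uses. The packets arriving in one frame, if there are any, form a bulk; bulks are numbered $m=1,2,\dots$ in the order of arrival, $T_m$ is the frame in which the $m$th bulk arrives, and $X_m$ is the number of its packets. Transmitting the $j$th packet of the $m$th bulk takes $S_{m,j}$ frames, where the $S_{m,j}$ are i.i.d. with distribution $P_\tau$ and independent of the arrivals, so that the service time of the $m$th bulk is $S_m=\sum_{j=1}^{X_m}S_{m,j}$. The queue has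 a single server, is first-come-first-served, and is empty at the start; a bulk can be served from the frame following its arrival on. Hence the waiting time $W_m$ and the delay $D_m$ of the $m$th bulk, in frames, satisfy $W_1=0$, $D_m=W_m+S_m$, $W_{m+1}=\max\{T_m+D_m-T_{m+1},0\}$. Theorem. Let $G_\tau(s)=\mathbb E[s^\tau]$. For every $(n,k,P_\tau,\varepsilon)$-VLSF code with $\mathbb E[\tau]<\infty$ that satisfies the stability condition $\lambda n\,\mathbb E[\tau]<1$, the delay $D_m$ converges in distribution, as $m\to\infty$, to a nonnegative-integer-valued random variable $D$ (the steady-state delay), and the probability generating function $G_D(s)=\mathbb E[s^D]$ is $$G_D(s)=\bigl(1-\lambda n\,\mathbb E[\tau]\bigr)\,\frac{(1-s)\bigl((1-\lambda)^n-(1-\lambda+\lambda G_\tau(s))^n\bigr)}{\bigl(1-(1-\lambda)^n\bigr)\bigl(s-(1-\lambda+\lambda G_\tau(s))^n\bigr)}$$ for all complex $s$ with $|s|\le 1$ and $s\ne 1$, where the denominator does not vanish. -/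

import Mathlib

open MeasureTheory ProbabilityTheory Filter Topology

/-- An `(n, k, Pτ, ε)`-VLSF (variable-length stop-feedback) code for the stationary memoryless
channel with transition law `κ` from the input alphabet `𝒳` to the output alphabet `𝒴`,
together with the probability space on which one packet is transmitted.  Channel uses are
numbered from `0`, so the first `t` frames are the uses `0, …, n * t - 1`. -/
structure VLSFCode.{u, v, w, x} {𝒳 : Type u} {𝒴 : Type v} [MeasurableSpace 𝒳] [MeasurableSpace 𝒴]
    (κ : Kernel 𝒳 𝒴) (n k : ℕ) (Pτ : Measure ℕ) (ε : ℝ) where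
  /-- the sample space -/
  Ω : Type w
  [mΩ : MeasurableSpace Ω]
  /-- the probability law on the sample space -/
  P : Measure Ω
  [isProb : IsProbabilityMeasure P]
  /-- the set in which the common randomness takes its values -/
  𝒰 : Type x
  [m𝒰 : MeasurableSpace 𝒰]
  /-- the common randomness -/
  U : Ω → 𝒰
  measurable_U : Measurable U
  /-- the message -/
  W : Ω → Fin (2 ^ k)
  measurable_W : Measurable W
  uniform_W : ∀ w, P.real {ω | W ω = w} = 1 / 2 ^ k
  indep_U_W : IndepFun U W P
  /-- the randomized encoder, which outputs an infinite codeword -/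
  enc : 𝒰 × Fin (2 ^ k) → ℕ → 𝒳
  measurable_enc : Measurable enc
  /-- the received sequence -/
  Y : ℕ → Ω → 𝒴
  measurable_Y : ∀ i, Measurable (Y i)
  /-- Given the common randomness and the message, the outputs are independent, and the `i`-th
  output has law `κ` at the `i`-th codeword symbol. -/
  memoryless : ∀ A : Set (𝒰 × Fin (2 ^ k)), MeasurableSet A →
    ∀ (N : ℕ) (B : ℕ → Set 𝒴), (∀ i, MeasurableSet (B i)) →
      P ({ω | (U ω, W ω) ∈ A} ∩ {ω | ∀ i < N, Y i ω ∈ B i}) =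
        ∫⁻ ω in {ω | (U ω, W ω) ∈ A}, ∏ i ∈ Finset.range N, κ (enc (U ω, W ω) i) (B i) ∂P
  /-- the decoder used at the `t`-th decoding attempt -/
  dec : (t : ℕ) → 𝒰 × (Fin (n * t) → 𝒴) → Fin (2 ^ k)
  measurable_dec : ∀ t, Measurable (dec t)
  /-- the number of frames until the decoder stops -/
  τ : Ω → ℕ
  /-- Whether the decoder has stopped after `t` frames is determined by the common randomness and
  the first `t` received frames. -/
  stopping : ∀ t, ∃ B : Set (𝒰 × (Fin (n * t) → 𝒴)), MeasurableSet B ∧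
    {ω | τ ω ≤ t} = {ω | (U ω, fun i : Fin (n * t) => Y i ω) ∈ B}
  law_τ : P.map τ = Pτ
  error_le : P.real {ω | dec (τ ω) (U ω, fun i : Fin (n * τ ω) => Y i ω) ≠ W ω} ≤ ε

/-- The random inputs of the queue.  `arr i` tells whether a packet arrives in channel use `i`:
these are i.i.d. Bernoulli with parameter `lam`.  `svc m j` is the number of frames needed to
transmit the `j`-th packet of the `m`-th bulk: these are i.i.d. with law `Pτ`, and they are
independent of the arrivals. -/
structure IsQueueInput {Ω : Type*} [MeasurableSpace Ω] (μ : Measure Ω) (lam : ℝ) (Pτ : Measure ℕ)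
    (arr : ℕ → Ω → Bool) (svc : ℕ → ℕ → Ω → ℕ) : Prop where
  measurable_arr : ∀ i, Measurable (arr i)
  measurable_svc : ∀ m j, Measurable (svc m j)
  prob_arr : ∀ i, μ.real {ω | arr i ω = true} = lam
  law_svc : ∀ m j, μ.map (svc m j) = Pτ
  indep_arr : iIndepFun arr μ
  indep_svc : iIndepFun (fun p : ℕ × ℕ => svc p.1 p.2) μ
  indep_arr_svc :
    IndepFun (fun ω (i : ℕ) => arr i ω) (fun ω (p : ℕ × ℕ) => svc p.1 p.2 ω) μ

section Queue

variable (n : ℕ) {Ω : Type*} (arr : ℕ → Ω → Bool) (svc : ℕ → ℕ → Ω → ℕ)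

/-- The number of packets that arrive in frame `t`, i.e. in the channel uses
`n * t, …, n * t + n - 1` (frames are numbered from `0`). -/
def frameArrivals (t : ℕ) (ω : Ω) : ℕ :=
  ∑ i ∈ Finset.range n, if arr (n * t + i) ω = true then 1 else 0

/-- The arrival time (frame) of the `m`-th bulk, bulks being numbered from `0`: the `m`-th frame
that contains an arrival. -/
noncomputable def bulkTime (m : ℕ) (ω : Ω) : ℕ :=
  Nat.nth (fun t => 0 < frameArrivals n arr t ω) m

/-- The number of packets in the `m`-th bulk. -/
noncomputable def bulkSize (m : ℕ) (ω : Ω) : ℕ :=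
  frameArrivals n arr (bulkTime n arr m ω) ω

/-- The number of frames needed to transmit all packets of the `m`-th bulk. -/
noncomputable def bulkService (m : ℕ) (ω : Ω) : ℕ :=
  ∑ j ∈ Finset.range (bulkSize n arr m ω), svc m j ω

/-- The last frame before the service of the `m`-th bulk begins, in the first-come-first-served
single-server queue that is empty at the start: a bulk that arrives in frame `t` can be served
from frame `t + 1` on, as soon as the previous bulk has been transmitted completely. -/
noncomputable def serviceStart : ℕ → Ω → ℕ
  | 0, ω => bulkTime n arr 0 ω
  | m + 1, ω => max (serviceStart m ω + bulkService n arr svc m ω) (bulkTime n arr (m + 1) ω)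

/-- The number of frames that the `m`-th bulk waits before its service begins. -/
noncomputable def bulkWaiting (m : ℕ) (ω : Ω) : ℕ :=
  serviceStart n arr svc m ω - bulkTime n arr m ω

/-- The delay of the `m`-th bulk, in frames: waiting time plus service time. -/
noncomputable def bulkDelay (m : ℕ) (ω : Ω) : ℕ :=
  bulkWaiting n arr svc m ω + bulkService n arr svc m ω

end Queue

/-- `D` is the steady-state law of the sequence `X` of `ℕ`-valued random variables: a probability
measure on `ℕ` to which the laws of the `X m` converge (in distribution) as `m → ∞`. -/
def IsSteadyStateLaw {Ω : Type*} [MeasurableSpace Ω] (μ : Measure Ω) (X : ℕ → Ω → ℕ)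
    (D : Measure ℕ) : Prop :=
  IsProbabilityMeasure D ∧
    ∀ j : ℕ, Tendsto (fun m => μ.real {ω | X m ω = j}) atTop (𝓝 (D.real {j}))

/-- The probability generating function `𝔼[s ^ X]` of a law on `ℕ`. -/
noncomputable def lawPGF (ν : Measure ℕ) (s : ℂ) : ℂ := ∫ x, s ^ x ∂ν

/-- The expectation of a law on `ℕ` (meaningful for laws with finite mean). -/
noncomputable def lawMean (ν : Measure ℕ) : ℝ := ∫ x, (x : ℝ) ∂ν

open scoped ENNReal

/-! Seen frame by frame, the queue is a Lindley walk: the workload satisfies V(t+1) = max(V(t) +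
service − 1, 0), and a bulk arriving in frame t waits exactly V(t) (`bulkWaiting_eq`). The input of
frame t is independent of the past. Let q be the probability of an idle frame and π the
sub-probability law of the service brought by a frame with arrivals. Summing over the possible
arrival frames of a bulk absorbs the geometric interarrival times and leaves an implicit recursion
between the laws of consecutive waiting times: ν(m+1) is q times ν(m+1) lowered by one, plus the
convolution of ν(m) and π lowered by one (`IsQueueStep`, `isQueueStep_waitingLaw`).

The queue starts empty, so the ν(m) increase stochastically (`antitone_lintegral_of_isQueueStep`)
and their point masses converge to those of a measure w, from which mass might have escaped to
infinity. In generating functions the recursion reads s·W' = q·W' + W·P − (1 − s)·c, where the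
boundary term c (`emptyMass`) comes from truncation at 0. Put A = q + P. As r increases to 1, (A(r)
− r)/(1 − r) tends to δ = 1 − λn·E[τ]. Monotonicity gives c ≥ δ at every step, hence also in the
limit, whereas the fixed-point equation for w gives c = δ·w(ℕ). Stability means δ > 0, so w has mass
1, and W(s)·(A(s) − s) = (1 − s)·δ is the Pollaczek–Khinchine formula (`exists_stationary_waiting`).

The delay adds an independent service time with generating function P/(1 − q), and A(s) = (1 − λ +
λG(s))^n (`idleProb_add_pgf_busyLaw`). The denominator cannot vanish because |1 − A(s)| ≤ λn·E[τ]·|1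
− s| (`norm_one_sub_compound_le`). -/

/-- The number of frames needed for as many packets as arrive in frame `t`, with the service times
of the `m`-th bulk. -/
def frameService (n : ℕ) {Ω : Type*} (arr : ℕ → Ω → Bool) (svc : ℕ → ℕ → Ω → ℕ)
    (m t : ℕ) (ω : Ω) : ℕ :=
  ∑ j ∈ Finset.range (frameArrivals n arr t ω), svc m j ω

/-- The number of bulks that arrive before frame `t`. -/
def bulkCount (n : ℕ) {Ω : Type*} (arr : ℕ → Ω → Bool) (t : ℕ) (ω : Ω) : ℕ :=
  Nat.count (fun s => 0 < frameArrivals n arr s ω) t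

/-- The work left over from the bulks that arrive before frame `t`. -/
def workload (n : ℕ) {Ω : Type*} (arr : ℕ → Ω → Bool) (svc : ℕ → ℕ → Ω → ℕ) : ℕ → Ω → ℕ
  | 0, _ => 0
  | t + 1, ω => workload n arr svc t ω + frameService n arr svc (bulkCount n arr t ω) t ω - 1

/-! ### Sample-path identities: waiting time as workload -/

section Deterministic

variable {n : ℕ} {Ω : Type*} {arr : ℕ → Ω → Bool} {svc : ℕ → ℕ → Ω → ℕ} {ω : Ω}

lemma bulkTime_eq {t : ℕ} (h : 0 < frameArrivals n arr t ω) :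
    bulkTime n arr (bulkCount n arr t ω) ω = t :=
  Nat.nth_count (p := fun s => 0 < frameArrivals n arr s ω) h

lemma frameArrivals_le (t : ℕ) : frameArrivals n arr t ω ≤ n := by
  refine (Finset.sum_le_card_nsmul _ _ 1 fun i _ => ?_).trans (by simp)
  split_ifs <;> simp

lemma frameService_of_eq_zero {m t : ℕ} (h : frameArrivals n arr t ω = 0) :
    frameService n arr svc m t ω = 0 := by
  simp [frameService, h]

lemma bulkService_eq {t : ℕ} (h : 0 < frameArrivals n arr t ω) :
    bulkService n arr svc (bulkCount n arr t ω) ω =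
      frameService n arr svc (bulkCount n arr t ω) t ω := by
  simp only [bulkService, bulkSize, bulkTime_eq h, frameService]

lemma bulkCount_succ_of_pos {t : ℕ} (h : 0 < frameArrivals n arr t ω) :
    bulkCount n arr (t + 1) ω = bulkCount n arr t ω + 1 := by
  simp [bulkCount, Nat.count_succ, h]

lemma bulkCount_succ_of_eq_zero {t : ℕ} (h : frameArrivals n arr t ω = 0) :
    bulkCount n arr (t + 1) ω = bulkCount n arr t ω := by
  simp [bulkCount, Nat.count_succ, h]

/-- Service of bulk m ends in frame `serviceStart + bulkService`, so the truncated difference with t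
counts the busy frames strictly after t. An arrival in frame t is served from t + 1 on, so this is
the work that it finds ahead of it. -/
lemma workload_eq (t : ℕ) : (bulkCount n arr t ω = 0 → workload n arr svc t ω = 0) ∧
    ∀ m, bulkCount n arr t ω = m + 1 → workload n arr svc t ω =
      serviceStart n arr svc m ω + bulkService n arr svc m ω - t := by
  induction t with
  | zero => simp [workload, bulkCount]
  | succ t ih =>
    obtain ⟨ih0, ih1⟩ := ih
    rcases Nat.eq_zero_or_pos (frameArrivals n arr t ω) with h | h
    · simp only [workload, bulkCount_succ_of_eq_zero h, frameService_of_eq_zero h]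
      refine ⟨fun h0 => by simp [ih0 h0], fun m hm => ?_⟩
      rw [ih1 m hm]
      omega
    · rw [bulkCount_succ_of_pos h]
      refine ⟨fun h0 => by omega, fun m hm => ?_⟩
      obtain rfl : bulkCount n arr t ω = m := by omega
      rw [workload, bulkService_eq h]
      have hT := bulkTime_eq h
      rcases hc : bulkCount n arr t ω with _ | k
      · rw [hc] at hT
        simp only [serviceStart, hT, ih0 hc]
        omega
      · rw [hc] at hT
        simp only [serviceStart, hT, ih1 k hc]
        omega

lemma bulkWaiting_eq {t : ℕ} (h : 0 < frameArrivals n arr t ω) :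
    bulkWaiting n arr svc (bulkCount n arr t ω) ω = workload n arr svc t ω := by
  have hT := bulkTime_eq h
  rw [bulkWaiting, hT]
  rcases hc : bulkCount n arr t ω with _ | k
  · rw [hc] at hT
    simp only [serviceStart, hT, (workload_eq t).1 hc]
    omega
  · rw [hc] at hT
    simp only [serviceStart, hT, (workload_eq t).2 k hc]
    omega

end Deterministic

/-! ### Independence of the past and the input of a frame -/

section Independence

variable {n : ℕ} {Ω : Type*} {arr : ℕ → Ω → Bool} {svc : ℕ → ℕ → Ω → ℕ}

/-- The σ-algebras generated by the individual arrival indicators and service times. -/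
@[reducible] def inputSigma {Ω : Type*} (arr : ℕ → Ω → Bool) (svc : ℕ → ℕ → Ω → ℕ) :
    ℕ ⊕ (ℕ × ℕ) → MeasurableSpace Ω :=
  Sum.elim (fun i => MeasurableSpace.comap (arr i) ⊤)
    (fun p => MeasurableSpace.comap (svc p.1 p.2) ⊤)

lemma measurable_sup_sigma {ι β : Type*} (M : ι → MeasurableSpace Ω) {S : Set ι} {i : ι}
    (hi : i ∈ S) {mβ : MeasurableSpace β} {f : Ω → β} (hf : Measurable[M i] f) :
    Measurable[⨆ i ∈ S, M i] f :=
  hf.mono (le_iSup₂_of_le i hi le_rfl) le_rfl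

lemma measurable_arr_sup {S : Set (ℕ ⊕ (ℕ × ℕ))} {i : ℕ} (hi : Sum.inl i ∈ S) :
    Measurable[⨆ i ∈ S, inputSigma arr svc i] (arr i) :=
  measurable_sup_sigma _ hi (comap_measurable _)

lemma measurable_svc_sup {S : Set (ℕ ⊕ (ℕ × ℕ))} {p : ℕ × ℕ} (hi : Sum.inr p ∈ S) :
    Measurable[⨆ i ∈ S, inputSigma arr svc i] (svc p.1 p.2) :=
  measurable_sup_sigma _ hi (comap_measurable _)

lemma measurable_frameArrivals {m : MeasurableSpace Ω} {t : ℕ}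
    (h : ∀ i < n, Measurable (arr (n * t + i))) : Measurable (frameArrivals n arr t) := by
  unfold frameArrivals
  refine Finset.measurable_fun_sum _ fun i hi => ?_
  exact (measurable_of_countable (fun b : Bool => if b = true then 1 else 0)).comp
    (h i (Finset.mem_range.1 hi))

lemma measurable_frameService {mΩ : MeasurableSpace Ω} {m t : ℕ}
    (h : ∀ i < n, Measurable (arr (n * t + i))) (h' : ∀ j, Measurable (svc m j)) :
    Measurable (frameService n arr svc m t) := by
  have hs : ∀ x, Measurable (fun ω => ∑ j ∈ Finset.range x, svc m j ω) := fun x =>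
    Finset.measurable_fun_sum _ fun j _ => h' j
  have hu : Measurable (Function.uncurry fun (x : ℕ) ω => ∑ j ∈ Finset.range x, svc m j ω) :=
    measurable_from_prod_countable_right hs
  exact hu.comp ((measurable_frameArrivals h).prodMk measurable_id)

lemma measurable_bulkCount {mΩ : MeasurableSpace Ω} {t : ℕ}
    (h : ∀ i < n * t, Measurable (arr i)) : Measurable (bulkCount n arr t) := by
  induction t with
  | zero =>
    have : bulkCount n arr 0 = fun _ => 0 := by ext; simp [bulkCount]
    exact this ▸ measurable_const
  | succ t ih =>
    have hF : Measurable (frameArrivals n arr t) := measurable_frameArrivals fun i hi =>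
      h _ (by rw [mul_add, mul_one]; omega)
    have : bulkCount n arr (t + 1) =
        fun ω => bulkCount n arr t ω + if 0 < frameArrivals n arr t ω then 1 else 0 := by
      ext ω; simp [bulkCount, Nat.count_succ]
    rw [this]
    exact (ih fun i hi => h i (by rw [mul_add]; omega)).add
      ((measurable_of_countable fun x : ℕ => if 0 < x then 1 else 0).comp hF)

lemma measurable_workload {mΩ : MeasurableSpace Ω} {t : ℕ}
    (h : ∀ i < n * t, Measurable (arr i)) (h' : ∀ m j, Measurable (svc m j)) :
    Measurable (workload n arr svc t) := by
  induction t with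
  | zero =>
    have : workload n arr svc 0 = fun _ => 0 := rfl
    exact this ▸ measurable_const
  | succ t ih =>
    have ha : ∀ i < n, Measurable (arr (n * t + i)) := fun i hi =>
      h _ (by rw [mul_add, mul_one]; omega)
    have hc : Measurable (bulkCount n arr t) := measurable_bulkCount fun i hi =>
      h i (by rw [mul_add]; omega)
    have hu : Measurable (Function.uncurry fun (m : ℕ) ω => frameService n arr svc m t ω) :=
      measurable_from_prod_countable_right fun m => measurable_frameService ha (h' m)
    have hV : Measurable fun ω => frameService n arr svc (bulkCount n arr t ω) t ω :=
      hu.comp (hc.prodMk measurable_id)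
    have := (ih fun i hi => h i (by rw [mul_add]; omega)).add hV
    exact (measurable_of_countable fun x : ℕ => x - 1).comp this

/-- On the event that m bulks have arrived, the workload involves only the service times of bulks
with index below m. Replacing all others by 0 leaves it unchanged and makes the restricted
dependence visible to the σ-algebra. -/
lemma measurableSet_state {mΩ : MeasurableSpace Ω} {t m : ℕ}
    (h : ∀ i < n * t, Measurable (arr i)) (h' : ∀ k < m, ∀ j, Measurable (svc k j)) (x : ℕ) :
    MeasurableSet {ω | bulkCount n arr t ω = m ∧ workload n arr svc t ω = x} := by
  have hc := measurable_bulkCount h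
  have hw : Measurable (workload n arr (fun k j ω => if k < m then svc k j ω else 0) t) := by
    refine measurable_workload h fun k j => ?_
    by_cases hk : k < m
    · simpa [hk] using h' k hk j
    · simp [hk]
  have key : ∀ s ω, bulkCount n arr s ω ≤ m → workload n arr svc s ω =
      workload n arr (fun k j ω => if k < m then svc k j ω else 0) s ω := by
    intro s ω hs
    induction s with
    | zero => rfl
    | succ s ih =>
      rcases Nat.eq_zero_or_pos (frameArrivals n arr s ω) with h | h
      · rw [bulkCount_succ_of_eq_zero h] at hs
        simp only [workload, frameService_of_eq_zero h, ih hs]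
      · rw [bulkCount_succ_of_pos h] at hs
        simp only [workload, ih (by omega), frameService]
        simp [show bulkCount n arr s ω < m by omega]
  have : {ω | bulkCount n arr t ω = m ∧ workload n arr svc t ω = x} =
      (bulkCount n arr t) ⁻¹' {m} ∩
        (workload n arr (fun k j ω => if k < m then svc k j ω else 0) t) ⁻¹' {x} := by
    ext ω
    simp only [Set.mem_ofPred_eq, Set.mem_inter_iff, Set.mem_preimage, Set.mem_singleton_iff]
    refine and_congr_right fun hm => ?_
    rw [key t ω hm.le]
  rw [this]
  exact (hc (measurableSet_singleton _)).inter (hw (measurableSet_singleton _))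

variable [MeasurableSpace Ω] {μ : Measure Ω} {lam : ℝ} {Pτ : Measure ℕ}

/-- Independence among arrivals, among service times, and between the two families merges into
independence of one family over the sum type: a finite intersection splits into its left and right
parts. -/
lemma iIndep_inputSigma (hin : IsQueueInput μ lam Pτ arr svc) :
    iIndep (inputSigma arr svc) μ := by
  classical
  rw [iIndep_iff]
  intro S f hf
  have hA : ∀ i : ℕ, Sum.inl i ∈ S → ∃ B : Set Bool, arr i ⁻¹' B = f (Sum.inl i) := by
    intro i hi
    obtain ⟨B, -, hB⟩ := hf _ hi
    exact ⟨B, hB⟩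
  have hC : ∀ p : ℕ × ℕ, Sum.inr p ∈ S → ∃ B : Set ℕ, svc p.1 p.2 ⁻¹' B = f (Sum.inr p) := by
    intro i hi
    obtain ⟨B, -, hB⟩ := hf _ hi
    exact ⟨B, hB⟩
  choose! B hB using hA
  choose! C hC using hC
  have h1 : (⋂ i ∈ S, f i) = (fun ω (i : ℕ) => arr i ω) ⁻¹' (⋂ i ∈ S.toLeft, {a | a i ∈ B i}) ∩
      (fun ω (p : ℕ × ℕ) => svc p.1 p.2 ω) ⁻¹' (⋂ p ∈ S.toRight, {a | a p ∈ C p}) := by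
    ext ω
    simp only [Set.mem_iInter, Set.mem_inter_iff, Set.mem_preimage, Finset.mem_toLeft,
      Finset.mem_toRight, Set.mem_ofPred_eq]
    constructor
    · intro h
      refine ⟨fun i hi => ?_, fun p hp => ?_⟩
      · have := h _ hi
        rwa [← hB i hi] at this
      · have := h _ hp
        rwa [← hC p hp] at this
    · rintro ⟨ha, hb⟩ (i | p) hi
      · rw [← hB i hi]
        exact ha i hi
      · rw [← hC p hi]
        exact hb p hi
  have m1 : MeasurableSet (⋂ i ∈ S.toLeft, {a : ℕ → Bool | a i ∈ B i}) :=
    Finset.measurableSet_biInter _ fun i _ => measurable_pi_apply i (Set.toFinite _).measurableSet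
  have m2 : MeasurableSet (⋂ p ∈ S.toRight, {a : ℕ × ℕ → ℕ | a p ∈ C p}) :=
    Finset.measurableSet_biInter _ fun i _ => measurable_pi_apply i (Set.to_countable _).measurableSet
  rw [h1, hin.indep_arr_svc.measure_inter_preimage_eq_mul _ _ m1 m2]
  have e1 := hin.indep_arr.measure_inter_preimage_eq_mul S.toLeft (sets := B)
    (fun i _ => (Set.toFinite _).measurableSet)
  have e2 := hin.indep_svc.measure_inter_preimage_eq_mul S.toRight (sets := C)
    (fun i _ => (Set.to_countable _).measurableSet)
  simp only [Set.preimage_iInter]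
  have e3 : ∏ i ∈ S, μ (f i) = (∏ i ∈ S.toLeft, μ (f (Sum.inl i))) *
      ∏ p ∈ S.toRight, μ (f (Sum.inr p)) := by
    conv_lhs => rw [← Finset.toLeft_disjSum_toRight (u := S)]
    rw [Finset.prod_disjSum]
  rw [e3]
  congr 1
  · exact e1.trans (Finset.prod_congr rfl fun i hi => by rw [hB i (Finset.mem_toLeft.1 hi)])
  · exact e2.trans (Finset.prod_congr rfl fun i hi => by rw [hC i (Finset.mem_toRight.1 hi)])

lemma inputSigma_le (hin : IsQueueInput μ lam Pτ arr svc) (i : ℕ ⊕ (ℕ × ℕ)) :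
    inputSigma arr svc i ≤ ‹MeasurableSpace Ω› := by
  rcases i with i | p
  · exact (hin.measurable_arr i).comap_le
  · exact (hin.measurable_svc p.1 p.2).comap_le

/-- The state of the queue before frame `t` is independent of the number of packets that arrive in
frame `t` and of the service times of the next bulk. -/
lemma measure_state_inter (hin : IsQueueInput μ lam Pτ arr svc) (t m x : ℕ) (A : Set (ℕ × ℕ)) :
    μ ({ω | bulkCount n arr t ω = m ∧ workload n arr svc t ω = x} ∩
        {ω | (frameArrivals n arr t ω, frameService n arr svc m t ω) ∈ A}) =
      μ {ω | bulkCount n arr t ω = m ∧ workload n arr svc t ω = x} *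
        μ {ω | (frameArrivals n arr t ω, frameService n arr svc m t ω) ∈ A} := by
  -- S is the past: channel uses before frame t and services of bulks before m. T holds the channel
  -- uses from frame t on and the services of bulk m alone.
  let S : Set (ℕ ⊕ (ℕ × ℕ)) := Sum.elim (fun i => i < n * t) (fun p => p.1 < m)
  let T : Set (ℕ ⊕ (ℕ × ℕ)) := Sum.elim (fun i => n * t ≤ i) (fun p => p.1 = m)
  have hST : Disjoint S T := by
    rw [Set.disjoint_left]
    rintro (i | p) h1 h2
    · exact absurd (show i < n * t from h1) (not_lt.2 (show n * t ≤ i from h2))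
    · exact absurd (show p.1 < m from h1) (not_lt.2 (show p.1 = m from h2).ge)
  have hi := indep_iSup_of_disjoint (inputSigma_le hin) (iIndep_inputSigma hin) hST
  refine (Indep_iff _ _ _).1 hi _ _ ?_ ?_
  · exact measurableSet_state (fun i hi => measurable_arr_sup hi)
      (fun k hk j => measurable_svc_sup (p := (k, j)) hk) x
  · have hA : ∀ i < n, Measurable[⨆ i ∈ T, inputSigma arr svc i] (arr (n * t + i)) :=
      fun i _ => measurable_arr_sup (show n * t ≤ n * t + i by omega)
    have := (@measurable_frameArrivals _ _ _ (_) _ hA).prodMk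
      (@measurable_frameService _ _ _ _ (_) m t hA
        (fun j => measurable_svc_sup (p := (m, j)) (show m = m from rfl)))
    exact this (Set.to_countable A).measurableSet

end Independence

/-! ### Laws of the input of one frame -/

section Laws

variable {n : ℕ} {Ω : Type*} {arr : ℕ → Ω → Bool} {svc : ℕ → ℕ → Ω → ℕ}
variable [MeasurableSpace Ω] {μ : Measure Ω} {lam : ℝ} {Pτ : Measure ℕ}

lemma map_arr_eq [IsProbabilityMeasure μ] (hin : IsQueueInput μ lam Pτ arr svc) (i k : ℕ) :
    μ.map (arr i) = μ.map (arr k) := by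
  have h : ∀ i, μ.map (arr i) {true} = ENNReal.ofReal lam := by
    intro i
    rw [Measure.map_apply (hin.measurable_arr i) (measurableSet_singleton _), ← hin.prob_arr i,
      ofReal_measureReal]
    rfl
  have h' : ∀ i, μ.map (arr i) {false} = 1 - ENNReal.ofReal lam := by
    intro i
    have := Measure.isProbabilityMeasure_map (μ := μ) (hin.measurable_arr i).aemeasurable
    rw [← h i, ← prob_compl_eq_one_sub (measurableSet_singleton _)]
    congr 1
    ext b
    cases b <;> simp
  refine Measure.ext_of_singleton fun b => ?_
  cases b
  · rw [h', h']
  · rw [h, h]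

lemma measurable_frameArrivals_input (hin : IsQueueInput μ lam Pτ arr svc) (t : ℕ) :
    Measurable (frameArrivals n arr t) :=
  measurable_frameArrivals fun _ _ => hin.measurable_arr _

lemma measurable_frameService_input (hin : IsQueueInput μ lam Pτ arr svc) (m t : ℕ) :
    Measurable (frameService n arr svc m t) :=
  measurable_frameService (fun _ _ => hin.measurable_arr _) fun _ => hin.measurable_svc _ _

lemma measurable_bulkCount_input (hin : IsQueueInput μ lam Pτ arr svc) (t : ℕ) :
    Measurable (bulkCount n arr t) :=
  measurable_bulkCount fun _ _ => hin.measurable_arr _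

lemma measurable_workload_input (hin : IsQueueInput μ lam Pτ arr svc) (t : ℕ) :
    Measurable (workload n arr svc t) :=
  measurable_workload (fun _ _ => hin.measurable_arr _) fun _ _ => hin.measurable_svc _ _

lemma iIndepFun_frame (hin : IsQueueInput μ lam Pτ arr svc) (t : ℕ) :
    iIndepFun (fun i : Fin n => arr (n * t + i)) μ :=
  hin.indep_arr.precomp (g := fun i : Fin n => n * t + i) fun i j h => by
    simpa [Fin.ext_iff] using h

lemma iIndepFun_bulk (hin : IsQueueInput μ lam Pτ arr svc) (m x : ℕ) :
    iIndepFun (fun j : Fin x => svc m j) μ :=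
  hin.indep_svc.precomp (g := fun j : Fin x => (m, (j : ℕ))) fun i j h => by
    simpa [Fin.ext_iff] using h

lemma measure_frameArrivals_eq [IsProbabilityMeasure μ] (hin : IsQueueInput μ lam Pτ arr svc)
    (t x : ℕ) : μ {ω | frameArrivals n arr t ω = x} = μ {ω | frameArrivals n arr 0 ω = x} := by
  have h : ∀ t, μ {ω | frameArrivals n arr t ω = x} = (Measure.pi fun _ : Fin n => μ.map (arr 0))
      {a | ∑ i, (if a i = true then 1 else 0) = x} := by
    intro t
    have := (iIndepFun_frame (n := n) hin t).map_fun_eq_pi_map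
      fun i => (hin.measurable_arr _).aemeasurable
    simp only [fun i : Fin n => map_arr_eq hin (n * t + i) 0] at this
    rw [← this, Measure.map_apply (measurable_pi_iff.2 fun i => hin.measurable_arr _)
      (Set.toFinite _).measurableSet]
    congr 1
    ext ω
    simp only [frameArrivals, Finset.sum_range, Set.mem_preimage, Set.mem_ofPred_eq]
  rw [h, h]

lemma measure_sum_svc_eq [IsProbabilityMeasure μ] (hin : IsQueueInput μ lam Pτ arr svc)
    (m x y : ℕ) : μ {ω | ∑ j ∈ Finset.range x, svc m j ω = y} =
      μ {ω | ∑ j ∈ Finset.range x, svc 0 j ω = y} := by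
  have h : ∀ m, μ {ω | ∑ j ∈ Finset.range x, svc m j ω = y} = (Measure.pi fun _ : Fin x => Pτ)
      {a | ∑ i, a i = y} := by
    intro m
    have := (iIndepFun_bulk hin m x).map_fun_eq_pi_map
      fun i => (hin.measurable_svc _ _).aemeasurable
    simp only [hin.law_svc] at this
    rw [← this, Measure.map_apply (measurable_pi_iff.2 fun i => hin.measurable_svc _ _)
      (Set.to_countable _).measurableSet]
    congr 1
    ext ω
    simp [Finset.sum_range]
  rw [h, h]

lemma indepFun_frameArrivals_sum (hin : IsQueueInput μ lam Pτ arr svc) (t m x : ℕ) :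
    IndepFun (frameArrivals n arr t) (fun ω => ∑ j ∈ Finset.range x, svc m j ω) μ := by
  refine hin.indep_arr_svc.comp (φ := frameArrivals n (fun i a => a i) t)
    (ψ := fun a => ∑ j ∈ Finset.range x, a (m, j)) ?_ ?_
  · exact measurable_frameArrivals fun i _ => measurable_pi_apply _
  · exact Finset.measurable_fun_sum _ fun j _ => measurable_pi_apply _

/-- The law of the service time of a frame with arrivals, as a measure whose mass is the
probability that a frame has arrivals. -/
noncomputable def busyLaw {Ω : Type*} [MeasurableSpace Ω] (n : ℕ) (μ : Measure Ω)
    (arr : ℕ → Ω → Bool) (svc : ℕ → ℕ → Ω → ℕ) : Measure ℕ :=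
  (μ.restrict {ω | 0 < frameArrivals n arr 0 ω}).map (frameService n arr svc 0 0)

/-- The probability that a frame has no arrivals. -/
noncomputable def idleProb {Ω : Type*} [MeasurableSpace Ω] (n : ℕ) (μ : Measure Ω)
    (arr : ℕ → Ω → Bool) : ℝ≥0∞ :=
  μ {ω | frameArrivals n arr 0 ω = 0}

instance [IsFiniteMeasure μ] : IsFiniteMeasure (busyLaw n μ arr svc) := by
  unfold busyLaw; infer_instance

/-- Conditioning on the number x + 1 of packets shows that the law depends neither on the frame nor
on the bulk, so a single measure serves the whole recursion. -/
lemma measure_busy_service [IsProbabilityMeasure μ] (hin : IsQueueInput μ lam Pτ arr svc)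
    (t m y : ℕ) : μ {ω | 0 < frameArrivals n arr t ω ∧ frameService n arr svc m t ω = y} =
      busyLaw n μ arr svc {y} := by
  have h : ∀ t m, μ {ω | 0 < frameArrivals n arr t ω ∧ frameService n arr svc m t ω = y} =
      ∑' x : ℕ, μ {ω | frameArrivals n arr 0 ω = x + 1} *
        μ {ω | ∑ j ∈ Finset.range (x + 1), svc 0 j ω = y} := by
    intro t m
    have hs : ∀ x, MeasurableSet {ω | frameArrivals n arr t ω = x} := fun x =>
      measurable_frameArrivals_input hin t (measurableSet_singleton x)
    have hs' : ∀ x, MeasurableSet {ω | ∑ j ∈ Finset.range x, svc m j ω = y} := fun x =>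
      (Finset.measurable_fun_sum _ fun j _ => hin.measurable_svc m j) (measurableSet_singleton y)
    have : {ω | 0 < frameArrivals n arr t ω ∧ frameService n arr svc m t ω = y} =
        ⋃ x : ℕ, {ω | frameArrivals n arr t ω = x + 1} ∩
          {ω | ∑ j ∈ Finset.range (x + 1), svc m j ω = y} := by
      ext ω
      simp only [Set.mem_ofPred_eq, Set.mem_iUnion, Set.mem_inter_iff, frameService]
      constructor
      · rintro ⟨h1, h2⟩
        exact ⟨frameArrivals n arr t ω - 1, by omega, by rwa [Nat.sub_add_cancel h1]⟩
      · rintro ⟨x, h1, h2⟩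
        exact ⟨by omega, by rwa [h1]⟩
    rw [this, measure_iUnion]
    · refine tsum_congr fun x => ?_
      rw [← measure_frameArrivals_eq hin t, ← measure_sum_svc_eq hin m]
      exact (indepFun_frameArrivals_sum hin t m (x + 1)).measure_inter_preimage_eq_mul
        {x + 1} {y} (measurableSet_singleton _) (measurableSet_singleton _)
    · intro x x' hx
      refine Set.disjoint_left.2 fun ω h1 h2 => hx ?_
      have e1 : frameArrivals n arr t ω = x + 1 := h1.1
      have e2 : frameArrivals n arr t ω = x' + 1 := h2.1
      omega
    · exact fun x => (hs _).inter (hs' _)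
  rw [h, ← h 0 0, busyLaw, Measure.map_apply (measurable_frameService_input hin 0 0)
    (measurableSet_singleton _), Measure.restrict_apply
      (measurable_frameService_input hin 0 0 (measurableSet_singleton _))]
  congr 1
  ext ω
  simp [and_comm]

lemma idleProb_add_busyLaw [IsProbabilityMeasure μ] (hin : IsQueueInput μ lam Pτ arr svc) :
    idleProb n μ arr + busyLaw n μ arr svc Set.univ = 1 := by
  rw [busyLaw, Measure.map_apply (measurable_frameService_input hin 0 0) MeasurableSet.univ,
    Set.preimage_univ, Measure.restrict_apply_univ, idleProb]
  have hs : MeasurableSet {ω | frameArrivals n arr 0 ω = 0} :=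
    measurable_frameArrivals_input hin 0 (measurableSet_singleton 0)
  rw [← measure_univ (μ := μ), ← measure_add_measure_compl hs]
  congr 2
  ext ω
  simp [Nat.pos_iff_ne_zero]

/-- Fixing the bulk count at m makes the index of the service times deterministic. The joint law of
workload and service on the busy event is then a product, which is checked on singletons. -/
lemma lintegral_busy [IsProbabilityMeasure μ] (hin : IsQueueInput μ lam Pτ arr svc)
    (t m : ℕ) (h : ℕ → ℕ → ℝ≥0∞) :
    ∫⁻ ω in {ω | bulkCount n arr t ω = m ∧ 0 < frameArrivals n arr t ω},
        h (workload n arr svc t ω) (frameService n arr svc m t ω) ∂μ =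
      ∫⁻ ω in {ω | bulkCount n arr t ω = m},
        ∫⁻ y, h (workload n arr svc t ω) y ∂busyLaw n μ arr svc ∂μ := by
  have hU := measurable_workload_input (n := n) hin t
  have hV := measurable_frameService_input (n := n) hin m t
  have hm : (μ.restrict {ω | bulkCount n arr t ω = m ∧ 0 < frameArrivals n arr t ω}).map
      (fun ω => (workload n arr svc t ω, frameService n arr svc m t ω)) =
      ((μ.restrict {ω | bulkCount n arr t ω = m}).map (workload n arr svc t)).prod
        (busyLaw n μ arr svc) := by
    refine Measure.ext_of_singleton fun ⟨x, y⟩ => ?_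
    rw [← Set.singleton_prod_singleton, Measure.prod_prod,
      Measure.map_apply (hU.prodMk hV) (Set.to_countable _).measurableSet,
      Measure.restrict_apply ((hU.prodMk hV) (Set.to_countable _).measurableSet),
      Measure.map_apply hU (Set.to_countable _).measurableSet,
      Measure.restrict_apply (hU (Set.to_countable _).measurableSet),
      ← measure_busy_service hin t m y]
    refine Eq.trans ?_ ((measure_state_inter (n := n) hin t m x {p | 0 < p.1 ∧ p.2 = y}).trans ?_)
    · congr 1
      ext ω
      simp only [Set.mem_inter_iff, Set.mem_preimage, Set.mem_prod, Set.mem_singleton_iff,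
        Set.mem_ofPred_eq]
      tauto
    · congr 2
      ext ω
      simp only [Set.mem_inter_iff, Set.mem_preimage, Set.mem_singleton_iff, Set.mem_ofPred_eq]
      tauto
  have h1 := lintegral_map (μ := μ.restrict
    {ω | bulkCount n arr t ω = m ∧ 0 < frameArrivals n arr t ω})
    (measurable_of_countable fun p : ℕ × ℕ => h p.1 p.2) (hU.prodMk hV)
  rw [← h1, hm, lintegral_prod _ (measurable_of_countable _).aemeasurable,
    lintegral_map (measurable_of_countable _) hU]

lemma lintegral_idle [IsProbabilityMeasure μ] (hin : IsQueueInput μ lam Pτ arr svc)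
    (t m : ℕ) (g : ℕ → ℝ≥0∞) :
    ∫⁻ ω in {ω | bulkCount n arr t ω = m ∧ frameArrivals n arr t ω = 0},
        g (workload n arr svc t ω) ∂μ =
      idleProb n μ arr * ∫⁻ ω in {ω | bulkCount n arr t ω = m}, g (workload n arr svc t ω) ∂μ := by
  have hU := measurable_workload_input (n := n) hin t
  have hm : (μ.restrict {ω | bulkCount n arr t ω = m ∧ frameArrivals n arr t ω = 0}).map
      (workload n arr svc t) = idleProb n μ arr •
      ((μ.restrict {ω | bulkCount n arr t ω = m}).map (workload n arr svc t)) := by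
    refine Measure.ext_of_singleton fun x => ?_
    rw [Measure.smul_apply, Measure.map_apply hU (measurableSet_singleton _),
      Measure.restrict_apply (hU (measurableSet_singleton _)),
      Measure.map_apply hU (measurableSet_singleton _),
      Measure.restrict_apply (hU (measurableSet_singleton _)), idleProb,
      ← measure_frameArrivals_eq hin t, smul_eq_mul, mul_comm]
    refine Eq.trans ?_ ((measure_state_inter (n := n) hin t m x {p | p.1 = 0}).trans ?_)
    · congr 1
      ext ω
      simp only [Set.mem_inter_iff, Set.mem_preimage, Set.mem_singleton_iff, Set.mem_ofPred_eq]
      tauto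
    · congr 2
      ext ω
      simp only [Set.mem_inter_iff, Set.mem_preimage, Set.mem_singleton_iff, Set.mem_ofPred_eq]
      tauto
  rw [← lintegral_map (measurable_of_countable g) hU, hm, lintegral_smul_measure,
    lintegral_map (measurable_of_countable g) hU, smul_eq_mul]

end Laws

/-! ### Recursion for the law of the waiting time -/

section Recursion

variable {n : ℕ} {Ω : Type*} {arr : ℕ → Ω → Bool} {svc : ℕ → ℕ → Ω → ℕ}
variable [MeasurableSpace Ω] {μ : Measure Ω} {lam : ℝ} {Pτ : Measure ℕ}

/-- The expectation of `g` of the workload before frame `t`, on the event that `m` bulks arrive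
before frame `t`. -/
noncomputable def stateIntegral (n : ℕ) {Ω : Type*} [MeasurableSpace Ω] (μ : Measure Ω)
    (arr : ℕ → Ω → Bool) (svc : ℕ → ℕ → Ω → ℕ) (m t : ℕ) (g : ℕ → ℝ≥0∞) : ℝ≥0∞ :=
  ∫⁻ ω in {ω | bulkCount n arr t ω = m}, g (workload n arr svc t ω) ∂μ

/-- The sum over all frames of `stateIntegral`. -/
noncomputable def occupation (n : ℕ) {Ω : Type*} [MeasurableSpace Ω] (μ : Measure Ω)
    (arr : ℕ → Ω → Bool) (svc : ℕ → ℕ → Ω → ℕ) (m : ℕ) (g : ℕ → ℝ≥0∞) : ℝ≥0∞ :=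
  ∑' t, stateIntegral n μ arr svc m t g

lemma measurableSet_bulkCount (hin : IsQueueInput μ lam Pτ arr svc) (t m : ℕ) :
    MeasurableSet {ω | bulkCount n arr t ω = m} :=
  measurable_bulkCount_input hin t (measurableSet_singleton m)

lemma measurableSet_busy (hin : IsQueueInput μ lam Pτ arr svc) (t m : ℕ) :
    MeasurableSet {ω | bulkCount n arr t ω = m ∧ 0 < frameArrivals n arr t ω} :=
  (measurableSet_bulkCount hin t m).inter
    (measurable_frameArrivals_input hin t (Set.to_countable {x | 0 < x}).measurableSet)

lemma measurableSet_idle (hin : IsQueueInput μ lam Pτ arr svc) (t m : ℕ) :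
    MeasurableSet {ω | bulkCount n arr t ω = m ∧ frameArrivals n arr t ω = 0} :=
  (measurableSet_bulkCount hin t m).inter
    (measurable_frameArrivals_input hin t (measurableSet_singleton 0))

lemma setLIntegral_idle_succ [IsProbabilityMeasure μ] (hin : IsQueueInput μ lam Pτ arr svc)
    (m t : ℕ) (g : ℕ → ℝ≥0∞) :
    ∫⁻ ω in {ω | bulkCount n arr t ω = m ∧ frameArrivals n arr t ω = 0},
        g (workload n arr svc (t + 1) ω) ∂μ =
      idleProb n μ arr * stateIntegral n μ arr svc m t (fun x => g (x - 1)) := by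
  rw [stateIntegral, ← lintegral_idle hin t m fun x => g (x - 1)]
  refine setLIntegral_congr_fun (measurableSet_idle hin t m) fun ω hω => ?_
  simp only [workload, frameService_of_eq_zero hω.2, add_zero]

lemma setLIntegral_busy_succ [IsProbabilityMeasure μ] (hin : IsQueueInput μ lam Pτ arr svc)
    (m t : ℕ) (g : ℕ → ℝ≥0∞) :
    ∫⁻ ω in {ω | bulkCount n arr t ω = m ∧ 0 < frameArrivals n arr t ω},
        g (workload n arr svc (t + 1) ω) ∂μ =
      stateIntegral n μ arr svc m t (fun x => ∫⁻ y, g (x + y - 1) ∂busyLaw n μ arr svc) := by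
  rw [stateIntegral, ← lintegral_busy hin t m fun x y => g (x + y - 1)]
  refine setLIntegral_congr_fun (measurableSet_busy hin t m) fun ω hω => ?_
  simp only [workload, hω.1]

lemma stateIntegral_zero_succ [IsProbabilityMeasure μ] (hin : IsQueueInput μ lam Pτ arr svc)
    (t : ℕ) (g : ℕ → ℝ≥0∞) :
    stateIntegral n μ arr svc 0 (t + 1) g =
      idleProb n μ arr * stateIntegral n μ arr svc 0 t (fun x => g (x - 1)) := by
  rw [← setLIntegral_idle_succ hin, stateIntegral]
  congr 2
  ext ω
  rcases Nat.eq_zero_or_pos (frameArrivals n arr t ω) with h | h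
  · simp [bulkCount_succ_of_eq_zero h, h]
  · simp [bulkCount_succ_of_pos h, h.ne']

/-- The count m + 1 after frame t arises in two ways: it was already reached and the frame was idle,
or bulk m arrived in this frame. -/
lemma stateIntegral_succ_succ [IsProbabilityMeasure μ] (hin : IsQueueInput μ lam Pτ arr svc)
    (m t : ℕ) (g : ℕ → ℝ≥0∞) :
    stateIntegral n μ arr svc (m + 1) (t + 1) g =
      idleProb n μ arr * stateIntegral n μ arr svc (m + 1) t (fun x => g (x - 1)) +
      stateIntegral n μ arr svc m t (fun x => ∫⁻ y, g (x + y - 1) ∂busyLaw n μ arr svc) := by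
  rw [← setLIntegral_idle_succ hin, ← setLIntegral_busy_succ hin,
    ← lintegral_union (measurableSet_busy hin t m), stateIntegral]
  · congr 2
    ext ω
    rcases Nat.eq_zero_or_pos (frameArrivals n arr t ω) with h | h
    · simp [bulkCount_succ_of_eq_zero h, h]
    · simp [bulkCount_succ_of_pos h, h.ne', h]
  · exact Set.disjoint_left.2 fun ω h1 h2 => h2.2.ne' h1.2

lemma stateIntegral_zero_zero [IsProbabilityMeasure μ] (g : ℕ → ℝ≥0∞) :
    stateIntegral n μ arr svc 0 0 g = g 0 := by
  simp [stateIntegral, bulkCount, workload]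

lemma stateIntegral_succ_zero (m : ℕ) (g : ℕ → ℝ≥0∞) :
    stateIntegral n μ arr svc (m + 1) 0 g = 0 := by
  simp [stateIntegral, bulkCount]

lemma occupation_zero [IsProbabilityMeasure μ] (hin : IsQueueInput μ lam Pτ arr svc)
    (g : ℕ → ℝ≥0∞) : occupation n μ arr svc 0 g =
      g 0 + idleProb n μ arr * occupation n μ arr svc 0 (fun x => g (x - 1)) := by
  rw [occupation, tsum_eq_zero_add' ENNReal.summable, stateIntegral_zero_zero]
  simp_rw [stateIntegral_zero_succ hin]
  rw [ENNReal.tsum_mul_left, occupation]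

lemma occupation_succ [IsProbabilityMeasure μ] (hin : IsQueueInput μ lam Pτ arr svc)
    (m : ℕ) (g : ℕ → ℝ≥0∞) : occupation n μ arr svc (m + 1) g =
      idleProb n μ arr * occupation n μ arr svc (m + 1) (fun x => g (x - 1)) +
      occupation n μ arr svc m (fun x => ∫⁻ y, g (x + y - 1) ∂busyLaw n μ arr svc) := by
  rw [occupation, tsum_eq_zero_add' ENNReal.summable, stateIntegral_succ_zero, zero_add]
  simp_rw [stateIntegral_succ_succ hin]
  rw [ENNReal.tsum_add, ENNReal.tsum_mul_left, occupation, occupation]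

lemma occupation_const_mul [IsProbabilityMeasure μ] (hin : IsQueueInput μ lam Pτ arr svc)
    (m : ℕ) (c : ℝ≥0∞) (g : ℕ → ℝ≥0∞) :
    occupation n μ arr svc m (fun x => c * g x) = c * occupation n μ arr svc m g := by
  simp only [occupation, stateIntegral]
  rw [← ENNReal.tsum_mul_left]
  refine tsum_congr fun t => lintegral_const_mul _ ?_
  exact (measurable_of_countable g).comp (measurable_workload_input hin t)

/-- The event that the `m`-th bulk arrives eventually. -/
def bulkEvent (n : ℕ) {Ω : Type*} (arr : ℕ → Ω → Bool) (m : ℕ) : Set Ω :=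
  ⋃ t, {ω | bulkCount n arr t ω = m ∧ 0 < frameArrivals n arr t ω}

/-- Bulk m arrives in at most one frame, so the event is a disjoint union over t. On each piece its
waiting time is the workload, which is independent of its service. -/
lemma lintegral_bulkEvent [IsProbabilityMeasure μ] (hin : IsQueueInput μ lam Pτ arr svc)
    (m : ℕ) (h : ℕ → ℕ → ℝ≥0∞) :
    ∫⁻ ω in bulkEvent n arr m, h (bulkWaiting n arr svc m ω) (bulkService n arr svc m ω) ∂μ =
      occupation n μ arr svc m (fun x => ∫⁻ y, h x y ∂busyLaw n μ arr svc) := by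
  rw [bulkEvent, lintegral_iUnion (fun t => measurableSet_busy hin t m)]
  · refine tsum_congr fun t => ?_
    rw [stateIntegral, ← lintegral_busy hin]
    refine setLIntegral_congr_fun (measurableSet_busy hin t m) fun ω hω => ?_
    obtain ⟨rfl, h2⟩ := hω
    simp only [bulkWaiting_eq h2, bulkService_eq h2]
  · intro t t' htt
    refine Set.disjoint_left.2 fun ω h1 h2 => htt ?_
    rw [← bulkTime_eq h1.2, ← bulkTime_eq h2.2, h1.1, h2.1]

lemma busyLaw_univ_ne_zero [IsProbabilityMeasure μ] (hin : IsQueueInput μ lam Pτ arr svc)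
    (hn : 0 < n) (hlam : 0 < lam) : busyLaw n μ arr svc Set.univ ≠ 0 := by
  rw [busyLaw, Measure.map_apply (measurable_frameService_input hin 0 0) MeasurableSet.univ,
    Set.preimage_univ, Measure.restrict_apply_univ]
  intro h0
  have : μ {ω | arr 0 ω = true} = 0 := by
    refine measure_mono_null (fun ω hω => ?_) h0
    have hω' : arr 0 ω = true := hω
    refine Finset.sum_pos' (fun _ _ => Nat.zero_le _) ⟨0, Finset.mem_range.2 hn, ?_⟩
    simp [hω']
  have h1 := hin.prob_arr 0
  rw [measureReal_def, this] at h1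
  exact hlam.ne h1

lemma measure_bulkEvent_eq [IsProbabilityMeasure μ] (hin : IsQueueInput μ lam Pτ arr svc)
    (m : ℕ) : μ (bulkEvent n arr m) =
      busyLaw n μ arr svc Set.univ * occupation n μ arr svc m (fun _ => 1) := by
  have := lintegral_bulkEvent (n := n) hin m fun _ _ => 1
  rw [setLIntegral_one, lintegral_one] at this
  rw [this, ← occupation_const_mul hin]
  simp

/-- With g = 1 the occupation recursion propagates mass 1 from each bulk to the next, once the
finite idle term is cancelled. Since every bulk thus arrives almost surely, the default value of
`Nat.nth` in `bulkTime` does not affect any law. -/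
lemma measure_bulkEvent [IsProbabilityMeasure μ] (hin : IsQueueInput μ lam Pτ arr svc)
    (hn : 0 < n) (hlam : 0 < lam) (m : ℕ) : μ (bulkEvent n arr m) = 1 := by
  have hp := busyLaw_univ_ne_zero hin hn hlam
  have hqp := idleProb_add_busyLaw (n := n) hin
  have hfin : ∀ m, idleProb n μ arr * occupation n μ arr svc m (fun _ => 1) ≠ ⊤ := by
    intro m
    have h1 : occupation n μ arr svc m (fun _ => 1) ≠ ⊤ := by
      intro htop
      -- Infinite occupation times a nonzero busy probability would give an event of infinite
      -- probability.
      have := measure_bulkEvent_eq (n := n) hin m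
      rw [htop, ENNReal.mul_top hp] at this
      exact measure_ne_top _ _ this
    exact ENNReal.mul_ne_top (measure_ne_top _ _) h1
  have hsplit : ∀ m, occupation n μ arr svc m (fun _ => 1) =
      idleProb n μ arr * occupation n μ arr svc m (fun _ => 1) + μ (bulkEvent n arr m) := by
    intro m
    rw [measure_bulkEvent_eq hin, ← add_mul, hqp, one_mul]
  induction m with
  | zero =>
    have h2 := occupation_zero (n := n) hin fun _ => 1
    exact (ENNReal.add_right_inj (hfin 0)).1 ((hsplit 0).symm.trans (h2.trans (add_comm _ _)))
  | succ m ih =>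
    have h2 := occupation_succ (n := n) hin m fun _ => 1
    rw [lintegral_one] at h2
    have h3 := occupation_const_mul (n := n) hin m (busyLaw n μ arr svc Set.univ) fun _ => 1
    simp only [mul_one] at h3
    rw [h3, ← measure_bulkEvent_eq hin, ih] at h2
    exact (ENNReal.add_right_inj (hfin (m + 1))).1 ((hsplit (m + 1)).symm.trans h2)

lemma restrict_bulkEvent [IsProbabilityMeasure μ] (hin : IsQueueInput μ lam Pτ arr svc)
    (hn : 0 < n) (hlam : 0 < lam) (m : ℕ) : μ.restrict (bulkEvent n arr m) = μ := by
  refine Measure.restrict_eq_self_of_ae_mem ?_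
  exact (prob_compl_eq_zero_iff (MeasurableSet.iUnion fun t => measurableSet_busy hin t m)).2
    (measure_bulkEvent hin hn hlam m)

lemma lintegral_waiting_service [IsProbabilityMeasure μ] (hin : IsQueueInput μ lam Pτ arr svc)
    (hn : 0 < n) (hlam : 0 < lam) (m : ℕ) (h : ℕ → ℕ → ℝ≥0∞) :
    ∫⁻ ω, h (bulkWaiting n arr svc m ω) (bulkService n arr svc m ω) ∂μ =
      occupation n μ arr svc m (fun x => ∫⁻ y, h x y ∂busyLaw n μ arr svc) := by
  rw [← lintegral_bulkEvent hin, restrict_bulkEvent hin hn hlam]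

lemma lintegral_waiting [IsProbabilityMeasure μ] (hin : IsQueueInput μ lam Pτ arr svc)
    (hn : 0 < n) (hlam : 0 < lam) (m : ℕ) (g : ℕ → ℝ≥0∞) :
    ∫⁻ ω, g (bulkWaiting n arr svc m ω) ∂μ =
      busyLaw n μ arr svc Set.univ * occupation n μ arr svc m g := by
  rw [lintegral_waiting_service hin hn hlam m fun x _ => g x, ← occupation_const_mul hin]
  simp only [lintegral_const, mul_comm]

/-- Bulk quantities are evaluated at a random frame. The arrival frame splits almost all of the
sample space into countably many pieces, and measurability is inherited from each piece. -/
lemma aemeasurable_of_busy [IsProbabilityMeasure μ] (hin : IsQueueInput μ lam Pτ arr svc)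
    (hn : 0 < n) (hlam : 0 < lam) {m : ℕ} {f : Ω → ℕ} {f' : ℕ → Ω → ℕ}
    (hf' : ∀ t, Measurable (f' t)) (hff : ∀ t ω, bulkCount n arr t ω = m →
      0 < frameArrivals n arr t ω → f ω = f' t ω) : AEMeasurable f μ := by
  rw [← restrict_bulkEvent hin hn hlam m, bulkEvent, aemeasurable_iUnion_iff]
  intro t
  refine (hf' t).aemeasurable.congr ?_
  filter_upwards [ae_restrict_mem (measurableSet_busy hin t m)] with ω hω
  exact (hff t ω hω.1 hω.2).symm

lemma aemeasurable_bulkWaiting [IsProbabilityMeasure μ] (hin : IsQueueInput μ lam Pτ arr svc)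
    (hn : 0 < n) (hlam : 0 < lam) (m : ℕ) : AEMeasurable (bulkWaiting n arr svc m) μ :=
  aemeasurable_of_busy (m := m) hin hn hlam (measurable_workload_input hin) fun t ω h1 h2 => by
    rw [← h1, bulkWaiting_eq h2]

lemma aemeasurable_bulkDelay [IsProbabilityMeasure μ] (hin : IsQueueInput μ lam Pτ arr svc)
    (hn : 0 < n) (hlam : 0 < lam) (m : ℕ) : AEMeasurable (bulkDelay n arr svc m) μ :=
  (aemeasurable_bulkWaiting hin hn hlam m).add <|
    aemeasurable_of_busy (m := m) hin hn hlam (measurable_frameService_input hin m)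
      fun t ω h1 h2 => by rw [← h1, bulkService_eq h2]

/-- The law of the waiting time of the `m`-th bulk. -/
noncomputable def waitingLaw (n : ℕ) {Ω : Type*} [MeasurableSpace Ω] (μ : Measure Ω)
    (arr : ℕ → Ω → Bool) (svc : ℕ → ℕ → Ω → ℕ) (m : ℕ) : Measure ℕ :=
  μ.map (bulkWaiting n arr svc m)

lemma waitingLaw_zero [IsProbabilityMeasure μ] :
    waitingLaw n μ arr svc 0 = Measure.dirac 0 := by
  have : bulkWaiting n arr svc 0 = fun _ => 0 := by
    ext ω
    simp [bulkWaiting, serviceStart]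
  rw [waitingLaw, this, Measure.map_const, measure_univ, one_smul]

lemma lintegral_waitingLaw [IsProbabilityMeasure μ] (hin : IsQueueInput μ lam Pτ arr svc)
    (hn : 0 < n) (hlam : 0 < lam) (m : ℕ) (g : ℕ → ℝ≥0∞) :
    ∫⁻ x, g x ∂waitingLaw n μ arr svc m =
      busyLaw n μ arr svc Set.univ * occupation n μ arr svc m g := by
  rw [waitingLaw, lintegral_map' (measurable_of_countable g).aemeasurable
    (aemeasurable_bulkWaiting hin hn hlam m), lintegral_waiting hin hn hlam]

/-- The recursion for the law of the waiting time. -/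
lemma lintegral_waitingLaw_succ [IsProbabilityMeasure μ] (hin : IsQueueInput μ lam Pτ arr svc)
    (hn : 0 < n) (hlam : 0 < lam) (m : ℕ) (g : ℕ → ℝ≥0∞) :
    ∫⁻ x, g x ∂waitingLaw n μ arr svc (m + 1) =
      idleProb n μ arr * ∫⁻ x, g (x - 1) ∂waitingLaw n μ arr svc (m + 1) +
      ∫⁻ x, ∫⁻ y, g (x + y - 1) ∂busyLaw n μ arr svc ∂waitingLaw n μ arr svc m := by
  simp only [lintegral_waitingLaw hin hn hlam]
  rw [occupation_succ hin]
  ring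

/-- This is the convolution of waiting and service laws; the factor on the left compensates for
`busyLaw` not being normalized. -/
lemma measure_bulkDelay [IsProbabilityMeasure μ] (hin : IsQueueInput μ lam Pτ arr svc)
    (hn : 0 < n) (hlam : 0 < lam) (m j : ℕ) :
    busyLaw n μ arr svc Set.univ * μ {ω | bulkDelay n arr svc m ω = j} =
      ∫⁻ x, busyLaw n μ arr svc {y | x + y = j} ∂waitingLaw n μ arr svc m := by
  have h1 : μ {ω | bulkDelay n arr svc m ω = j} =
      ∫⁻ ω, ({j} : Set ℕ).indicator 1 (bulkDelay n arr svc m ω) ∂μ := by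
    rw [← lintegral_map' (measurable_of_countable (({j} : Set ℕ).indicator 1)).aemeasurable
      (aemeasurable_bulkDelay hin hn hlam m), lintegral_indicator_one (measurableSet_singleton _),
      Measure.map_apply_of_aemeasurable (aemeasurable_bulkDelay hin hn hlam m)
        (measurableSet_singleton _)]
    rfl
  have h2 := lintegral_waiting_service hin hn hlam m fun x y => ({j} : Set ℕ).indicator 1 (x + y)
  rw [h1, lintegral_waitingLaw hin hn hlam]
  congr 1
  refine h2.trans ?_
  congr 1
  ext x
  rw [← lintegral_indicator_one (Set.to_countable _).measurableSet]
  rfl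

end Recursion

/-! ### Generating functions and truncation at zero -/

section PGF

variable {𝕜 : Type*} [RCLike 𝕜]

lemma integrable_of_norm_le_one {α : Type*} [Countable α] [MeasurableSpace α]
    [MeasurableSingletonClass α] {ν : Measure α} [IsFiniteMeasure ν] {f : α → 𝕜}
    (hf : ∀ x, ‖f x‖ ≤ 1) : Integrable f ν :=
  Integrable.of_bound (measurable_of_countable f).aestronglyMeasurable 1 (ae_of_all _ hf)

lemma norm_pow_le_one {s : 𝕜} (hs : ‖s‖ ≤ 1) (x : ℕ) : ‖s ^ x‖ ≤ 1 := by
  rw [norm_pow]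
  exact pow_le_one₀ (norm_nonneg _) hs

lemma integrable_pow {ν : Measure ℕ} [IsFiniteMeasure ν] {s : 𝕜} (hs : ‖s‖ ≤ 1) :
    Integrable (fun x : ℕ => s ^ x) ν :=
  integrable_of_norm_le_one (norm_pow_le_one hs)

/-- At x = 0 truncated subtraction gives s · 1 in place of 1. This defect 1 − s is the source of the
boundary term in the waiting-time equation. -/
lemma mul_pow_pred (s : 𝕜) (x : ℕ) :
    s * s ^ (x - 1) = s ^ x - (1 - s) * ({0} : Set ℕ).indicator (fun _ => 1) x := by
  rcases x with _ | x
  · simp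
  · simp [pow_succ']

lemma integral_pow_pred {α : Type*} [Countable α] [MeasurableSpace α]
    [MeasurableSingletonClass α] {ν : Measure α} [IsFiniteMeasure ν] {s : 𝕜} (hs : ‖s‖ ≤ 1)
    (f : α → ℕ) :
    s * ∫ x, s ^ (f x - 1) ∂ν = ∫ x, s ^ f x ∂ν - (1 - s) * (ν.real (f ⁻¹' {0}) : 𝕜) := by
  have hm : MeasurableSet (f ⁻¹' {0}) := (Set.to_countable _).measurableSet
  rw [← integral_const_mul]
  simp_rw [mul_pow_pred]
  have h1 : ∀ x, ({0} : Set ℕ).indicator (fun _ => (1 : 𝕜)) (f x) =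
      (f ⁻¹' {0}).indicator (fun _ => (1 : 𝕜)) x := fun x => rfl
  simp_rw [h1]
  rw [integral_sub (integrable_of_norm_le_one fun x => norm_pow_le_one hs _)
    (((integrable_const (1 : 𝕜)).indicator hm).const_mul _), integral_const_mul,
    integral_indicator_const _ hm]
  simp [RCLike.real_smul_eq_coe_mul]

lemma integral_pow_add {ν π : Measure ℕ} [IsFiniteMeasure ν] [IsFiniteMeasure π] (s : 𝕜) :
    ∫ p : ℕ × ℕ, s ^ (p.1 + p.2) ∂ν.prod π = (∫ x, s ^ x ∂ν) * ∫ x, s ^ x ∂π := by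
  simp_rw [pow_add]
  exact integral_prod_mul (fun x : ℕ => s ^ x) fun x : ℕ => s ^ x

/-- Abel's limit recovers the total mass, which later detects whether mass has escaped. -/
lemma tendsto_integral_pow (ν : Measure ℕ) [IsFiniteMeasure ν] :
    Tendsto (fun r : ℝ => ∫ x, r ^ x ∂ν) (𝓝[<] 1) (𝓝 (ν.real Set.univ)) := by
  have h1 : ν.real Set.univ = ∫ x : ℕ, (1 : ℝ) ^ x ∂ν := by simp
  rw [h1]
  refine tendsto_integral_filter_of_dominated_convergence (fun _ => 1)
    (Eventually.of_forall fun r => (measurable_of_countable _).aestronglyMeasurable) ?_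
    (integrable_const _) (ae_of_all _ fun x => ?_)
  · have : ∀ᶠ r : ℝ in 𝓝[<] 1, r ∈ Set.Ioo 0 1 := Ioo_mem_nhdsLT (by norm_num)
    filter_upwards [this] with r hr
    refine ae_of_all _ fun x => norm_pow_le_one ?_ x
    rw [Real.norm_eq_abs, abs_of_pos hr.1]
    exact hr.2.le
  · exact ((continuous_pow x).tendsto (1 : ℝ)).mono_left nhdsWithin_le_nhds

end PGF

/-! ### The Lindley recursion and its stationary law -/

section Lindley

/-- One step of the waiting-time recursion, in the form of an equation between the laws `ν` and `ν'`
of consecutive waiting times: with probability `q` the next frame is idle and one frame of the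
remaining work is done, and otherwise a bulk arrives, whose service time has (sub-probability) law
`π`. -/
def IsQueueStep (q : ℝ≥0∞) (π ν ν' : Measure ℕ) : Prop :=
  ν' = q • ν'.map (fun x => x - 1) + (ν.prod π).map (fun p => p.1 + p.2 - 1)

variable {q : ℝ≥0∞} {π : Measure ℕ}

lemma IsQueueStep.lintegral [SFinite π] {ν ν' : Measure ℕ} (h : IsQueueStep q π ν ν') (g : ℕ → ℝ≥0∞) :
    ∫⁻ x, g x ∂ν' = q * ∫⁻ x, g (x - 1) ∂ν' + ∫⁻ x, ∫⁻ y, g (x + y - 1) ∂π ∂ν := by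
  conv_lhs => rw [h]
  rw [lintegral_add_measure, lintegral_smul_measure,
    lintegral_map (measurable_of_countable g) (measurable_of_countable _),
    lintegral_map (measurable_of_countable g) (measurable_of_countable _),
    lintegral_prod _ (measurable_of_countable _).aemeasurable, smul_eq_mul]

lemma isQueueStep_of_singleton [SFinite π] {ν ν' : Measure ℕ}
    (h : ∀ j, ν' {j} = q * ν' {x | x - 1 = j} + ∫⁻ x, π {y | x + y - 1 = j} ∂ν) :
    IsQueueStep q π ν ν' := by
  refine Measure.ext_of_singleton fun j => ?_
  rw [Measure.add_apply, Measure.smul_apply,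
    Measure.map_apply (measurable_of_countable _) (measurableSet_singleton _),
    Measure.map_apply (measurable_of_countable _) (measurableSet_singleton _),
    Measure.prod_apply (Set.to_countable _).measurableSet, smul_eq_mul]
  exact h j

lemma IsQueueStep.singleton [SFinite π] {ν ν' : Measure ℕ} (h : IsQueueStep q π ν ν') (j : ℕ) :
    ν' {j} = q * ν' {x | x - 1 = j} + ∫⁻ x, π {y | x + y - 1 = j} ∂ν := by
  conv_lhs => rw [h]
  rw [Measure.add_apply, Measure.smul_apply,
    Measure.map_apply (measurable_of_countable _) (measurableSet_singleton _),
    Measure.map_apply (measurable_of_countable _) (measurableSet_singleton _),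
    Measure.prod_apply (Set.to_countable _).measurableSet, smul_eq_mul]
  rfl

section Sequence

variable {ν : ℕ → Measure ℕ}

/-- The step is monotone in the stochastic order and the initial law, a unit mass at 0, is the
smallest. Decreasing test functions remain decreasing under both operations in the step, which
drives the induction. -/
lemma antitone_lintegral_of_isQueueStep [SFinite π] [∀ m, IsProbabilityMeasure (ν m)]
    (hq : q + π Set.univ = 1) (hπ : π Set.univ ≠ 0) (h0 : ν 0 = Measure.dirac 0)
    (hrec : ∀ m, IsQueueStep q π (ν m) (ν (m + 1))) {g : ℕ → ℝ≥0∞} (hg : Antitone g)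
    (hg1 : ∀ x, g x ≤ 1) : Antitone fun m => ∫⁻ x, g x ∂ν m := by
  refine antitone_nat_of_succ_le fun m => ?_
  have hq1 : q < 1 := by
    refine lt_of_le_of_ne (hq ▸ le_self_add) fun h => hπ ?_
    rw [h] at hq
    exact (ENNReal.add_right_inj ENNReal.one_ne_top).1 (hq.trans (add_zero 1).symm)
  induction m generalizing g with
  | zero =>
    rw [h0, lintegral_dirac]
    calc ∫⁻ x, g x ∂ν (0 + 1) ≤ ∫⁻ _, g 0 ∂ν (0 + 1) := lintegral_mono fun x => hg (Nat.zero_le x)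
      _ = g 0 := by simp
  | succ m ih =>
    -- The new law occurs on both sides of the recursion. Each unrolling multiplies that occurrence
    -- by q, so N unrollings leave an error of at most q^N, and q < 1.
    have key : ∀ (N : ℕ) (g : ℕ → ℝ≥0∞), Antitone g → (∀ x, g x ≤ 1) →
        ∫⁻ x, g x ∂ν (m + 1 + 1) ≤ ∫⁻ x, g x ∂ν (m + 1) + q ^ N := by
      intro N
      induction N with
      | zero =>
        intro g hg hg1
        calc ∫⁻ x, g x ∂ν (m + 1 + 1) ≤ ∫⁻ _, 1 ∂ν (m + 1 + 1) := lintegral_mono hg1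
          _ = 1 := by simp
          _ ≤ _ := by simp
      | succ N ihN =>
        intro g hg hg1
        have h1 := ihN (fun x => g (x - 1)) (fun x y hxy => hg (by omega)) fun x => hg1 _
        have h2 := ih (g := fun x => ∫⁻ y, g (x + y - 1) ∂π)
          (fun x y hxy => lintegral_mono fun z => hg (by omega)) fun x => by
            calc ∫⁻ y, g (x + y - 1) ∂π ≤ ∫⁻ _, 1 ∂π := lintegral_mono fun z => hg1 _
              _ = π Set.univ := by simp
              _ ≤ 1 := hq ▸ le_add_self
        rw [(hrec (m + 1)).lintegral g, (hrec m).lintegral g]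
        calc q * ∫⁻ x, g (x - 1) ∂ν (m + 1 + 1) + ∫⁻ x, ∫⁻ y, g (x + y - 1) ∂π ∂ν (m + 1)
            ≤ q * (∫⁻ x, g (x - 1) ∂ν (m + 1) + q ^ N) + ∫⁻ x, ∫⁻ y, g (x + y - 1) ∂π ∂ν m := by
              gcongr
          _ = _ := by ring
    have hlim : Tendsto (fun N => ∫⁻ x, g x ∂ν (m + 1) + q ^ N) atTop
        (𝓝 (∫⁻ x, g x ∂ν (m + 1) + 0)) :=
      (ENNReal.tendsto_pow_atTop_nhds_zero_of_lt_one hq1).const_add _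
    rw [add_zero] at hlim
    exact ge_of_tendsto' hlim fun N => key N g hg hg1

end Sequence

variable [IsFiniteMeasure π]

/-- The probability of an idle server at the start of a frame, up to normalization. -/
noncomputable def emptyMass (q : ℝ≥0∞) (π ν ν' : Measure ℕ) : ℝ :=
  q.toReal * ν'.real {0} + ν.real {0} * π.real {0}

lemma IsQueueStep.pgf {𝕜 : Type*} [RCLike 𝕜] {ν ν' : Measure ℕ} [IsFiniteMeasure ν]
    [IsFiniteMeasure ν'] (h : IsQueueStep q π ν ν') (hq : q ≠ ⊤) {s : 𝕜} (hs : ‖s‖ ≤ 1) :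
    s * ∫ x, s ^ x ∂ν' = (q.toReal : 𝕜) * ∫ x, s ^ x ∂ν' + (∫ x, s ^ x ∂ν) * (∫ x, s ^ x ∂π) -
      (1 - s) * (emptyMass q π ν ν' : 𝕜) := by
  have h1 : ∫ x, s ^ x ∂ν' =
      (q.toReal : 𝕜) * ∫ x, s ^ (x - 1) ∂ν' + ∫ p : ℕ × ℕ, s ^ (p.1 + p.2 - 1) ∂ν.prod π := by
    conv_lhs => rw [h]
    have : IsFiniteMeasure (q • ν'.map (fun x => x - 1)) := ν'.map _ |>.smul_finite hq
    rw [integral_add_measure (integrable_pow hs) (integrable_pow hs), integral_smul_measure,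
      integral_map (measurable_of_countable _).aemeasurable
        (measurable_of_countable _).aestronglyMeasurable,
      integral_map (measurable_of_countable _).aemeasurable
        (measurable_of_countable _).aestronglyMeasurable, RCLike.real_smul_eq_coe_mul]
  have h2 := integral_pow_pred (ν := ν') hs id
  have h3 := integral_pow_pred (ν := ν.prod π) hs fun p => p.1 + p.2
  have h4 : (fun p : ℕ × ℕ => p.1 + p.2) ⁻¹' {0} = {0} ×ˢ {0} := by
    ext ⟨x, y⟩
    simp
  rw [integral_pow_add, h4, measureReal_prod_prod] at h3
  simp only [id, Set.preimage_id] at h2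
  conv_lhs => rw [h1]
  rw [mul_add, h3, mul_left_comm, h2, emptyMass]
  push_cast
  ring

variable {ν : ℕ → Measure ℕ}

/-- Monotone distribution functions converge, and point masses are their differences. Only total
mass at most 1 is claimed, since tightness is not yet known. -/
lemma exists_tendsto_singleton [∀ m, IsProbabilityMeasure (ν m)]
    (hanti : ∀ k : ℕ, Antitone fun m => ν m (Set.Iio k)) :
    ∃ w : Measure ℕ, w Set.univ ≤ 1 ∧ ∀ j, Tendsto (fun m => ν m {j}) atTop (𝓝 (w {j})) := by
  have h1 : ∀ j, ∃ a, Tendsto (fun m => ν m {j}) atTop (𝓝 a) := by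
    intro j
    have h2 : ∀ m, ν m {j} = ν m (Set.Iio (j + 1)) - ν m (Set.Iio j) := by
      intro m
      rw [← measure_sdiff (Set.Iio_subset_Iio (Nat.le_succ j))
        (Set.to_countable _).measurableSet.nullMeasurableSet (measure_ne_top _ _)]
      congr 1
      ext x
      simp only [Set.mem_singleton_iff, Set.mem_sdiff, Set.mem_Iio]
      omega
    simp_rw [h2]
    refine ⟨_, ENNReal.Tendsto.sub (tendsto_atTop_iInf (hanti (j + 1)))
      (tendsto_atTop_iInf (hanti j)) (Or.inl ?_)⟩
    exact ((iInf_le (fun m => ν m (Set.Iio (j + 1))) 0).trans_lt (measure_lt_top _ _)).ne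
  choose a ha using h1
  have hw : ∀ j, Measure.sum (fun i => a i • Measure.dirac i) {j} = a j := by
    intro j
    rw [Measure.sum_apply _ (measurableSet_singleton j), tsum_eq_single j]
    · simp
    · intro i hi
      simp [hi]
  refine ⟨Measure.sum fun i => a i • Measure.dirac i, ?_, fun j => by rw [hw]; exact ha j⟩
  rw [Measure.sum_apply _ MeasurableSet.univ]
  simp only [Measure.smul_apply, measure_univ, smul_eq_mul, mul_one]
  refine ENNReal.tsum_le_of_sum_range_le fun k => ?_
  refine le_of_tendsto' (tendsto_finsetSum _ fun j _ => ha j) fun m => ?_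
  rw [sum_measure_singleton]
  exact prob_le_one

/-- Finite support turns the integral into a finite sum, so escaping mass does no harm. -/
lemma tendsto_lintegral_of_finite_support {w : Measure ℕ}
    (hw : ∀ j, Tendsto (fun m => ν m {j}) atTop (𝓝 (w {j}))) {h : ℕ → ℝ≥0∞} (k : ℕ)
    (hk : ∀ x, k ≤ x → h x = 0) (hfin : ∀ x, h x ≠ ⊤) :
    Tendsto (fun m => ∫⁻ x, h x ∂ν m) atTop (𝓝 (∫⁻ x, h x ∂w)) := by
  have h1 : ∀ ν : Measure ℕ, ∫⁻ x, h x ∂ν = ∑ x ∈ Finset.range k, h x * ν {x} := by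
    intro ν
    rw [lintegral_countable']
    refine tsum_eq_sum fun x hx => ?_
    rw [hk x (by simpa using hx), zero_mul]
  simp_rw [h1]
  exact tendsto_finsetSum _ fun x _ => ENNReal.Tendsto.const_mul (hw x) (Or.inr (hfin x))

lemma isQueueStep_limit (hq : q ≠ ⊤) {w : Measure ℕ}
    (hw : ∀ j, Tendsto (fun m => ν m {j}) atTop (𝓝 (w {j})))
    (hrec : ∀ m, IsQueueStep q π (ν m) (ν (m + 1))) : IsQueueStep q π w w := by
  refine isQueueStep_of_singleton fun j => ?_
  have hw' : ∀ j, Tendsto (fun m => ν (m + 1) {j}) atTop (𝓝 (w {j})) := fun j =>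
    (tendsto_add_atTop_iff_nat 1).2 (hw j)
  refine tendsto_nhds_unique (hw' j) ?_
  simp_rw [fun m => (hrec m).singleton j]
  refine Tendsto.add (ENNReal.Tendsto.const_mul ?_ (Or.inr hq)) ?_
  · have h1 : ∀ ν : Measure ℕ, ν {x | x - 1 = j} =
        ∫⁻ x, ({x | x - 1 = j} : Set ℕ).indicator 1 x ∂ν := fun ν =>
      (lintegral_indicator_one (Set.to_countable _).measurableSet).symm
    simp_rw [h1]
    -- Only x ≤ j + 1 can reach j after one unit is removed, whence the cutoff j + 2 here and in the
    -- convolution term.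
    refine tendsto_lintegral_of_finite_support hw' (j + 2) (fun x hx => ?_) fun x => ?_
    · refine Set.indicator_of_notMem (fun h => ?_) _
      have : x - 1 = j := h
      omega
    · exact ne_top_of_le_ne_top ENNReal.one_ne_top (Set.indicator_le_self _ _ x)
  · refine tendsto_lintegral_of_finite_support hw (j + 2) (fun x hx => ?_)
      fun x => measure_ne_top _ _
    convert measure_empty (μ := π)
    ext y
    simp only [Set.mem_ofPred_eq, Set.mem_empty_iff_false, iff_false]
    omega

/-- The waiting times of a stable queue converge in distribution, and the probability generating
function of the limit is given by the Pollaczek–Khinchine formula. -/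
theorem exists_stationary_waiting [∀ m, IsProbabilityMeasure (ν m)]
    (hq : q + π Set.univ = 1) (hπ : π Set.univ ≠ 0) (h0 : ν 0 = Measure.dirac 0)
    (hrec : ∀ m, IsQueueStep q π (ν m) (ν (m + 1))) {δ : ℝ} (hδ : 0 < δ)
    (hlim : Tendsto (fun r : ℝ => (q.toReal + ∫ x, r ^ x ∂π - r) / (1 - r)) (𝓝[<] 1) (𝓝 δ)) :
    ∃ w : Measure ℕ, IsProbabilityMeasure w ∧
      (∀ j, Tendsto (fun m => ν m {j}) atTop (𝓝 (w {j}))) ∧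
      ∀ s : ℂ, ‖s‖ ≤ 1 →
        (∫ x, s ^ x ∂w) * ((q.toReal : ℂ) + ∫ x, s ^ x ∂π - s) = (1 - s) * (δ : ℂ) := by
  have hqtop : q ≠ ⊤ := ne_top_of_le_ne_top ENNReal.one_ne_top (hq ▸ le_self_add)
  have hmono : ∀ {g : ℕ → ℝ≥0∞}, Antitone g → (∀ x, g x ≤ 1) →
      Antitone fun m => ∫⁻ x, g x ∂ν m := fun hg hg1 =>
    antitone_lintegral_of_isQueueStep hq hπ h0 hrec hg hg1
  obtain ⟨w, hw1, hw⟩ := exists_tendsto_singleton (ν := ν) fun k => by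
    have h1 : ∀ m, ν m (Set.Iio k) = ∫⁻ x, (Set.Iio k).indicator 1 x ∂ν m := fun m =>
      (lintegral_indicator_one measurableSet_Iio).symm
    simp_rw [h1]
    refine hmono (fun x y hxy => ?_) fun x => Set.indicator_le_self _ _ x
    by_cases hy : y ∈ Set.Iio k
    · have hx : x ∈ Set.Iio k := lt_of_le_of_lt hxy hy
      rw [Set.indicator_of_mem hy, Set.indicator_of_mem hx]
      rfl
    · rw [Set.indicator_of_notMem hy]
      exact zero_le
  have : IsFiniteMeasure w := ⟨hw1.trans_lt ENNReal.one_lt_top⟩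
  have hstep := isQueueStep_limit hqtop hw hrec
  -- Taking r above q makes the coefficient r − q of the next generating function positive, so that
  -- monotonicity can be used below.
  have hev : ∀ᶠ r : ℝ in 𝓝[<] 1, r ∈ Set.Ioo q.toReal 1 := by
    refine Ioo_mem_nhdsLT ?_
    have : q < 1 := by
      refine lt_of_le_of_ne (hq ▸ le_self_add) fun h => hπ ?_
      rw [h] at hq
      exact (ENNReal.add_right_inj ENNReal.one_ne_top).1 (hq.trans (add_zero 1).symm)
    simpa using (ENNReal.toReal_lt_toReal hqtop ENNReal.one_ne_top).2 this
  have hnorm : ∀ {r : ℝ}, r ∈ Set.Ioo q.toReal 1 → ‖r‖ ≤ 1 := fun {r} hr => by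
    rw [Real.norm_eq_abs, abs_of_pos (ENNReal.toReal_nonneg.trans_lt hr.1)]
    exact hr.2.le
  -- Since the generating function at r ∈ (q, 1) decreases in m, replacing W(m+1) by W(m) gives (1 −
  -- r)·c ≥ W(m)(r)·(q + P(r) − r). Dividing by 1 − r and letting r tend to 1 yields c ≥ δ, because
  -- ν(m) has mass 1.
  have hc : ∀ m, δ ≤ emptyMass q π (ν m) (ν (m + 1)) := by
    intro m
    have h1 := (tendsto_integral_pow (ν m)).mul hlim
    rw [probReal_univ, one_mul] at h1
    refine le_of_tendsto h1 ?_
    filter_upwards [hev] with r hr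
    have hr0 : 0 ≤ r := ENNReal.toReal_nonneg.trans hr.1.le
    have h2 := (hrec m).pgf hqtop (hnorm hr)
    have h3 : ∫ x, r ^ x ∂ν (m + 1) ≤ ∫ x, r ^ x ∂ν m := by
      have h4 := hmono (g := fun x => ENNReal.ofReal (r ^ x))
        (fun x y hxy => ENNReal.ofReal_le_ofReal (pow_le_pow_of_le_one hr0 hr.2.le hxy))
        (fun x => ENNReal.ofReal_le_one.2 (pow_le_one₀ hr0 hr.2.le)) (Nat.le_succ m)
      have h5 : ∀ m, ∫ x, r ^ x ∂ν m = (∫⁻ x, ENNReal.ofReal (r ^ x) ∂ν m).toReal := fun m =>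
        integral_eq_lintegral_of_nonneg_ae (ae_of_all _ fun x => pow_nonneg hr0 x)
          (measurable_of_countable _).aestronglyMeasurable
      rw [h5, h5]
      refine ENNReal.toReal_mono ?_ h4
      refine ((lintegral_mono (g := fun _ => 1) fun x =>
        ENNReal.ofReal_le_one.2 (pow_le_one₀ hr0 hr.2.le)).trans_lt ?_).ne
      simp
    rw [← mul_div_assoc, div_le_iff₀ (sub_pos.2 hr.2)]
    simp only [RCLike.ofReal_real_eq_id, id] at h2
    have h6 := mul_le_mul_of_nonneg_left h3 (sub_nonneg.2 hr.1.le)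
    linarith
  have hcw : δ ≤ emptyMass q π w w := by
    have hreal : Tendsto (fun m => (ν m).real {0}) atTop (𝓝 (w.real {0})) :=
      (ENNReal.tendsto_toReal (measure_ne_top _ _)).comp (hw 0)
    have h1 : Tendsto (fun m => emptyMass q π (ν m) (ν (m + 1))) atTop (𝓝 (emptyMass q π w w)) :=
      (((tendsto_add_atTop_iff_nat 1).2 hreal).const_mul _).add (hreal.mul_const _)
    exact ge_of_tendsto' h1 hc
  -- For the fixed point w the same comparison is an equality, with the possibly defective mass of w
  -- as a factor.
  have hmass : w.real Set.univ * δ = emptyMass q π w w := by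
    refine tendsto_nhds_unique ((tendsto_integral_pow w).mul hlim) ?_
    refine tendsto_const_nhds.congr' ?_
    filter_upwards [hev] with r hr
    have h2 := hstep.pgf hqtop (hnorm hr)
    simp only [RCLike.ofReal_real_eq_id, id] at h2
    rw [← mul_div_assoc, eq_div_iff (sub_pos.2 hr.2).ne']
    linarith
  have hw1' : w.real Set.univ ≤ 1 := ENNReal.toReal_mono ENNReal.one_ne_top hw1
  -- No mass escapes: w(ℕ)·δ ≥ δ with δ > 0.
  have hone : w.real Set.univ = 1 := by
    refine le_antisymm hw1' ?_
    rw [← hmass] at hcw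
    exact le_of_mul_le_mul_right (by linarith) hδ
  rw [hone, one_mul] at hmass
  refine ⟨w, ⟨?_⟩, hw, fun s hs => ?_⟩
  · rw [← ofReal_measureReal (μ := w), hone, ENNReal.ofReal_one]
  · have h2 := hstep.pgf hqtop hs
    rw [hmass]
    simp only [RCLike.ofReal_eq_complex_ofReal] at h2
    linear_combination -h2

end Lindley

/-! ### Generating function of the service brought by a frame -/

section Service

variable {n : ℕ} {Ω : Type*} {arr : ℕ → Ω → Bool} {svc : ℕ → ℕ → Ω → ℕ}
variable [MeasurableSpace Ω] {μ : Measure Ω} {lam : ℝ} {Pτ : Measure ℕ}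
variable {𝕜 : Type*} [RCLike 𝕜]

lemma integral_pow_frameArrivals [IsProbabilityMeasure μ]
    (hin : IsQueueInput μ lam Pτ arr svc) (z : 𝕜) :
    ∫ ω, z ^ frameArrivals n arr 0 ω ∂μ = (1 - lam + lam * z) ^ n := by
  have h1 : ∀ ω, z ^ frameArrivals n arr 0 ω =
      ∏ i : Fin n, (fun b : Bool => if b = true then z else 1) (arr (n * 0 + i) ω) := by
    intro ω
    rw [frameArrivals, Finset.sum_range, ← Finset.prod_pow_eq_pow_sum]
    refine Finset.prod_congr rfl fun i _ => ?_
    split_ifs <;> simp_all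
  have h2 : ∀ i, ∫ ω, (if arr i ω = true then z else 1) ∂μ = 1 - lam + lam * z := by
    intro i
    have hm : MeasurableSet {ω | arr i ω = true} :=
      hin.measurable_arr i (measurableSet_singleton true)
    have h3 : ∀ ω, (if arr i ω = true then z else 1) =
        1 + {ω | arr i ω = true}.indicator (fun _ => z - 1) ω := by
      intro ω
      by_cases h : arr i ω = true <;> simp [h]
    simp_rw [h3]
    rw [integral_add (integrable_const _) ((integrable_const _).indicator hm),
      integral_indicator_const _ hm, hin.prob_arr i, RCLike.real_smul_eq_coe_mul]
    simp
    ring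
  simp_rw [h1]
  rw [(iIndepFun_frame hin 0).integral_fun_prod_comp
    (f := fun _ (b : Bool) => if b = true then z else 1)
    (fun i => (hin.measurable_arr _).aemeasurable)
    fun i => (measurable_of_countable _).aestronglyMeasurable]
  simp_rw [h2]
  simp

lemma idleProb_toReal [IsProbabilityMeasure μ]
    (hin : IsQueueInput μ lam Pτ arr svc) :
    (idleProb n μ arr).toReal = (1 - lam) ^ n := by
  have hm : MeasurableSet {ω | frameArrivals n arr 0 ω = 0} :=
    measurable_frameArrivals_input hin 0 (measurableSet_singleton 0)
  have h1 := integral_pow_frameArrivals (n := n) hin (0 : ℝ)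
  have h2 : ∀ ω, (0 : ℝ) ^ frameArrivals n arr 0 ω =
      {ω | frameArrivals n arr 0 ω = 0}.indicator 1 ω := by
    intro ω
    by_cases h : frameArrivals n arr 0 ω = 0 <;> simp [h]
  simp_rw [h2] at h1
  rw [integral_indicator_one hm] at h1
  simpa [idleProb, measureReal_def] using h1

lemma integral_pow_sum_svc (hin : IsQueueInput μ lam Pτ arr svc) (x : ℕ) (s : 𝕜) :
    ∫ ω, s ^ ∑ j ∈ Finset.range x, svc 0 j ω ∂μ = (∫ k, s ^ k ∂Pτ) ^ x := by
  have h1 : ∀ ω, s ^ ∑ j ∈ Finset.range x, svc 0 j ω =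
      ∏ j : Fin x, (fun k : ℕ => s ^ k) (svc 0 j ω) := by
    intro ω
    rw [Finset.sum_range, ← Finset.prod_pow_eq_pow_sum]
  simp_rw [h1]
  rw [(iIndepFun_bulk hin 0 x).integral_fun_prod_comp (f := fun _ (k : ℕ) => s ^ k)
    (fun i => (hin.measurable_svc _ _).aemeasurable)
    fun i => (measurable_of_countable _).aestronglyMeasurable]
  have h2 : ∀ j, ∫ ω, s ^ svc 0 j ω ∂μ = ∫ k, s ^ k ∂Pτ := by
    intro j
    rw [← hin.law_svc 0 j, integral_map (hin.measurable_svc 0 j).aemeasurable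
      (measurable_of_countable _).aestronglyMeasurable]
  simp_rw [h2]
  simp

lemma integral_pow_frameService [IsProbabilityMeasure μ]
    (hin : IsQueueInput μ lam Pτ arr svc) {s : 𝕜} (hs : ‖s‖ ≤ 1) :
    ∫ ω, s ^ frameService n arr svc 0 0 ω ∂μ = (1 - lam + lam * ∫ k, s ^ k ∂Pτ) ^ n := by
  have hF := measurable_frameArrivals_input (n := n) hin 0
  have hS : ∀ x, Measurable fun ω => ∑ j ∈ Finset.range x, svc 0 j ω := fun x =>
    Finset.measurable_fun_sum _ fun j _ => hin.measurable_svc 0 j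
  have hP : IsProbabilityMeasure Pτ := by
    rw [← hin.law_svc 0 0]
    exact Measure.isProbabilityMeasure_map (hin.measurable_svc 0 0).aemeasurable
  set G := ∫ k, s ^ k ∂Pτ
  -- At most n packets arrive in a frame, so conditioning on their number is a finite sum and random
  -- sums reduce to sums of fixed length.
  have hsum : ∀ (f : ℕ → 𝕜) (ω : Ω), f (frameArrivals n arr 0 ω) = ∑ x ∈ Finset.range (n + 1),
      (if frameArrivals n arr 0 ω = x then 1 else 0) * f x := by
    intro f ω
    have := frameArrivals_le (n := n) (arr := arr) (ω := ω) 0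
    simp [this]
  have hind : ∀ x, Measurable fun ω => if frameArrivals n arr 0 ω = x then (1 : 𝕜) else 0 :=
    fun x => (measurable_of_countable fun k : ℕ => if k = x then (1 : 𝕜) else 0).comp hF
  have hpow : ∀ x, Measurable fun ω => s ^ ∑ j ∈ Finset.range x, svc 0 j ω := fun x =>
    (measurable_of_countable fun k : ℕ => s ^ k).comp (hS x)
  have hle : ∀ x ω, ‖(if frameArrivals n arr 0 ω = x then (1 : 𝕜) else 0)‖ ≤ 1 := by
    intro x ω
    split_ifs <;> simp
  rw [← integral_pow_frameArrivals hin G]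
  simp_rw [frameService, fun ω => hsum (fun x => G ^ x) ω,
    fun ω => hsum (fun x => s ^ ∑ j ∈ Finset.range x, svc 0 j ω) ω]
  rw [integral_finsetSum, integral_finsetSum]
  · refine Finset.sum_congr rfl fun x _ => ?_
    have hi : IndepFun (fun ω => if frameArrivals n arr 0 ω = x then (1 : 𝕜) else 0)
        (fun ω => s ^ ∑ j ∈ Finset.range x, svc 0 j ω) μ :=
      (indepFun_frameArrivals_sum hin 0 0 x).comp
        (φ := fun k : ℕ => if k = x then (1 : 𝕜) else 0) (ψ := fun k : ℕ => s ^ k)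
        (measurable_of_countable _) (measurable_of_countable _)
    rw [hi.integral_fun_mul_eq_mul_integral (hind x).aestronglyMeasurable
      (hpow x).aestronglyMeasurable, integral_pow_sum_svc hin, integral_mul_const]
  · exact fun x _ => (Integrable.of_bound (hind x).aestronglyMeasurable 1
      (ae_of_all _ (hle x))).mul_const _
  · refine fun x _ => Integrable.of_bound ((hind x).mul (hpow x)).aestronglyMeasurable 1
      (ae_of_all _ fun ω => ?_)
    rw [norm_mul]
    exact mul_le_one₀ (hle x ω) (norm_nonneg _) (norm_pow_le_one hs _)

/-- An idle frame brings zero service and contributes s^0 = 1, so adding its probability completes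
the compound binomial generating function. -/
lemma idleProb_add_pgf_busyLaw [IsProbabilityMeasure μ]
    (hin : IsQueueInput μ lam Pτ arr svc) {s : 𝕜} (hs : ‖s‖ ≤ 1) :
    ((idleProb n μ arr).toReal : 𝕜) + ∫ x, s ^ x ∂busyLaw n μ arr svc =
      (1 - lam + lam * ∫ k, s ^ k ∂Pτ) ^ n := by
  have hV := measurable_frameService_input (n := n) hin 0 0
  have hm : MeasurableSet {ω | frameArrivals n arr 0 ω = 0} :=
    measurable_frameArrivals_input hin 0 (measurableSet_singleton 0)
  have hc : {ω | frameArrivals n arr 0 ω = 0}ᶜ = {ω | 0 < frameArrivals n arr 0 ω} := by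
    ext ω
    simp [Nat.pos_iff_ne_zero]
  have hi : Integrable (fun ω => s ^ frameService n arr svc 0 0 ω) μ :=
    Integrable.of_bound ((measurable_of_countable fun k : ℕ => s ^ k).comp hV).aestronglyMeasurable
      1 (ae_of_all _ fun ω => norm_pow_le_one hs _)
  have hsplit := integral_add_compl hm hi
  rw [hc] at hsplit
  rw [← integral_pow_frameService hin hs, busyLaw, integral_map hV.aemeasurable
    (measurable_of_countable _).aestronglyMeasurable, ← hsplit]
  congr 1
  have h1 : Set.EqOn (fun ω => s ^ frameService n arr svc 0 0 ω) (fun _ => 1)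
      {ω | frameArrivals n arr 0 ω = 0} := fun ω hω => by
    simp only [frameService_of_eq_zero hω, pow_zero]
  rw [setIntegral_congr_fun hm h1]
  simp [idleProb, measureReal_def, RCLike.real_smul_eq_coe_mul]

end Service

/-! ### First-order behaviour at s = 1 -/

section Mean

variable {ν : Measure ℕ} [IsProbabilityMeasure ν]

lemma norm_one_sub_pow_le {s : ℂ} (hs : ‖s‖ ≤ 1) (x : ℕ) : ‖1 - s ^ x‖ ≤ x * ‖1 - s‖ := by
  rw [← mul_neg_geom_sum, norm_mul, mul_comm]
  refine mul_le_mul_of_nonneg_right ((norm_sum_le _ _).trans ?_) (norm_nonneg _)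
  exact (Finset.sum_le_card_nsmul _ _ 1 fun i _ => norm_pow_le_one hs i).trans (by simp)

lemma norm_integral_pow_le {s : ℂ} (hs : ‖s‖ ≤ 1) : ‖∫ x, s ^ x ∂ν‖ ≤ 1 := by
  refine (norm_integral_le_of_norm_le_const (ae_of_all _ fun x => norm_pow_le_one hs x)).trans ?_
  simp

lemma norm_one_sub_integral_pow_le (hint : Integrable (fun x : ℕ => (x : ℝ)) ν) {s : ℂ}
    (hs : ‖s‖ ≤ 1) : ‖1 - ∫ x, s ^ x ∂ν‖ ≤ lawMean ν * ‖1 - s‖ := by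
  have h1 : 1 - ∫ x, s ^ x ∂ν = ∫ x : ℕ, (1 - s ^ x) ∂ν := by
    rw [integral_sub (integrable_const _) (integrable_pow hs)]
    simp
  rw [h1, lawMean, ← integral_mul_const]
  exact norm_integral_le_of_norm_le (hint.mul_const _) (ae_of_all _ (norm_one_sub_pow_le hs))

/-- The compound generating function is Lipschitz at 1 on the closed disc, with the mean work per
frame as constant. Below load 1 this excludes any fixed point s ≠ 1, even on the unit circle. -/
lemma norm_one_sub_compound_le (hint : Integrable (fun x : ℕ => (x : ℝ)) ν) {lam : ℝ}
    (h0 : 0 ≤ lam) (h1 : lam ≤ 1) (n : ℕ) {s : ℂ} (hs : ‖s‖ ≤ 1) :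
    ‖1 - (1 - lam + lam * ∫ x, s ^ x ∂ν) ^ n‖ ≤ lam * n * lawMean ν * ‖1 - s‖ := by
  have hz : ‖1 - lam + lam * ∫ x, s ^ x ∂ν‖ ≤ 1 := by
    have e : (1 - lam + lam * ∫ x, s ^ x ∂ν : ℂ) = ((1 - lam : ℝ) : ℂ) + lam * ∫ x, s ^ x ∂ν := by
      push_cast
      rfl
    rw [e]
    refine (norm_add_le _ _).trans ?_
    rw [norm_mul, Complex.norm_of_nonneg h0, Complex.norm_of_nonneg (sub_nonneg.2 h1)]
    have := mul_le_mul_of_nonneg_left (norm_integral_pow_le (ν := ν) hs) h0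
    linarith
  have h2 : ‖1 - (1 - lam + lam * ∫ x, s ^ x ∂ν)‖ = lam * ‖1 - ∫ x, s ^ x ∂ν‖ := by
    rw [← Complex.norm_of_nonneg h0, ← norm_mul, Complex.norm_of_nonneg h0]
    congr 1
    ring
  calc _ ≤ _ := norm_one_sub_pow_le hz n
    _ ≤ n * (lam * (lawMean ν * ‖1 - s‖)) := by
      rw [h2]
      gcongr
      exact norm_one_sub_integral_pow_le hint hs
    _ = _ := by ring

/-- The quotient (1 − r^x)/(1 − r) is a geometric sum, dominated by x and tending to x. Dominated
convergence therefore needs only the first moment. -/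
lemma tendsto_one_sub_integral_pow_div (hint : Integrable (fun x : ℕ => (x : ℝ)) ν) :
    Tendsto (fun r : ℝ => (1 - ∫ x, r ^ x ∂ν) / (1 - r)) (𝓝[<] 1) (𝓝 (lawMean ν)) := by
  have hev : ∀ᶠ r : ℝ in 𝓝[<] 1, r ∈ Set.Ioo 0 1 := Ioo_mem_nhdsLT (by norm_num)
  have h1 : Tendsto (fun r : ℝ => ∫ x : ℕ, ∑ i ∈ Finset.range x, r ^ i ∂ν) (𝓝[<] 1)
      (𝓝 (∫ x : ℕ, (x : ℝ) ∂ν)) := by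
    refine tendsto_integral_filter_of_dominated_convergence (fun x : ℕ => (x : ℝ))
      (Eventually.of_forall fun r => (measurable_of_countable _).aestronglyMeasurable) ?_
      hint (ae_of_all _ fun x => ?_)
    · filter_upwards [hev] with r hr
      refine ae_of_all _ fun x => (norm_sum_le _ _).trans ?_
      refine (Finset.sum_le_card_nsmul _ _ 1 fun i _ => norm_pow_le_one ?_ i).trans (by simp)
      rw [Real.norm_eq_abs, abs_of_pos hr.1]
      exact hr.2.le
    · have hcont : Continuous fun r : ℝ => ∑ i ∈ Finset.range x, r ^ i := by fun_prop
      simpa using (hcont.tendsto 1).mono_left nhdsWithin_le_nhds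
  refine h1.congr' ?_
  filter_upwards [hev] with r hr
  have hr1 : ‖r‖ ≤ 1 := by
    rw [Real.norm_eq_abs, abs_of_pos hr.1]
    exact hr.2.le
  rw [eq_div_iff (sub_pos.2 hr.2).ne', ← integral_mul_const]
  simp_rw [geom_sum_mul_neg]
  rw [integral_sub (integrable_const _) (integrable_pow hr1)]
  simp

lemma tendsto_compound_sub_div (hint : Integrable (fun x : ℕ => (x : ℝ)) ν) (lam : ℝ) (n : ℕ) :
    Tendsto (fun r : ℝ => ((1 - lam + lam * ∫ x, r ^ x ∂ν) ^ n - r) / (1 - r)) (𝓝[<] 1)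
      (𝓝 (1 - lam * n * lawMean ν)) := by
  have h1 := tendsto_one_sub_integral_pow_div hint
  have h2 : Tendsto (fun r : ℝ => 1 - lam + lam * ∫ x, r ^ x ∂ν) (𝓝[<] 1) (𝓝 1) := by
    simpa using ((tendsto_integral_pow ν).const_mul lam).const_add (1 - lam)
  have h3 : Tendsto (fun r : ℝ => ∑ i ∈ Finset.range n, (1 - lam + lam * ∫ x, r ^ x ∂ν) ^ i)
      (𝓝[<] 1) (𝓝 n) := by
    have hcont : Continuous fun z : ℝ => ∑ i ∈ Finset.range n, z ^ i := by fun_prop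
    simpa [Function.comp_def] using (hcont.tendsto 1).comp h2
  have h4 := ((h1.const_mul lam).mul h3).const_sub 1
  rw [mul_right_comm] at h4
  refine h4.congr' ?_
  filter_upwards [self_mem_nhdsWithin] with r hr
  have hr' : 1 - r ≠ 0 := (sub_pos.2 hr).ne'
  have h5 := mul_neg_geom_sum (1 - lam + lam * ∫ x, r ^ x ∂ν) n
  field_simp
  linear_combination -h5

end Mean

/-! ### Steady-state delay and the final formula -/

lemma isQueueStep_waitingLaw {n : ℕ} {Ω : Type*} [MeasurableSpace Ω] {μ : Measure Ω}
    [IsProbabilityMeasure μ] {arr : ℕ → Ω → Bool} {svc : ℕ → ℕ → Ω → ℕ} {lam : ℝ}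
    {Pτ : Measure ℕ} (hin : IsQueueInput μ lam Pτ arr svc) (hn : 0 < n) (hlam : 0 < lam) (m : ℕ) :
    IsQueueStep (idleProb n μ arr) (busyLaw n μ arr svc) (waitingLaw n μ arr svc m)
      (waitingLaw n μ arr svc (m + 1)) := by
  refine isQueueStep_of_singleton fun j => ?_
  have h := lintegral_waitingLaw_succ hin hn hlam m (({j} : Set ℕ).indicator 1)
  rw [lintegral_indicator_one (measurableSet_singleton j)] at h
  rw [h]
  congr 1
  · rw [← lintegral_indicator_one (Set.to_countable _).measurableSet]
    rfl
  · refine lintegral_congr fun x => ?_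
    rw [← lintegral_indicator_one (Set.to_countable _).measurableSet]
    rfl

/-- This reduces the formula for an arbitrary steady-state law to the one constructed explicitly. -/
lemma IsSteadyStateLaw.unique {Ω : Type*} [MeasurableSpace Ω] {μ : Measure Ω} {X : ℕ → Ω → ℕ}
    {D D' : Measure ℕ} (h : IsSteadyStateLaw μ X D) (h' : IsSteadyStateLaw μ X D') : D = D' := by
  have := h.1
  have := h'.1
  refine Measure.ext_of_singleton fun j => ?_
  rw [← ofReal_measureReal (μ := D), ← ofReal_measureReal (μ := D'),
    tendsto_nhds_unique (h.2 j) (h'.2 j)]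

/-- The delay equals j only if the waiting time is at most j, so convergence of the point masses of
the waiting time passes directly to the delay. -/
lemma isSteadyStateLaw_bulkDelay {n : ℕ} {Ω : Type*} [MeasurableSpace Ω] {μ : Measure Ω}
    [IsProbabilityMeasure μ] {arr : ℕ → Ω → Bool} {svc : ℕ → ℕ → Ω → ℕ} {lam : ℝ}
    {Pτ : Measure ℕ} (hin : IsQueueInput μ lam Pτ arr svc) (hn : 0 < n) (hlam : 0 < lam)
    {w : Measure ℕ} [IsProbabilityMeasure w]
    (hw : ∀ j, Tendsto (fun m => waitingLaw n μ arr svc m {j}) atTop (𝓝 (w {j}))) :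
    IsSteadyStateLaw μ (bulkDelay n arr svc) ((busyLaw n μ arr svc Set.univ)⁻¹ •
      (w.prod (busyLaw n μ arr svc)).map fun p => p.1 + p.2) := by
  have hp := busyLaw_univ_ne_zero hin hn hlam
  have hp' := measure_ne_top (busyLaw n μ arr svc) Set.univ
  have hprob : IsProbabilityMeasure ((busyLaw n μ arr svc Set.univ)⁻¹ •
      (w.prod (busyLaw n μ arr svc)).map fun p => p.1 + p.2) := by
    refine ⟨?_⟩
    rw [Measure.smul_apply, Measure.map_apply (measurable_of_countable _) MeasurableSet.univ,
      Set.preimage_univ, ← Set.univ_prod_univ, Measure.prod_prod, measure_univ (μ := w), one_mul,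
      smul_eq_mul, ENNReal.inv_mul_cancel hp hp']
  refine ⟨hprob, fun j => (ENNReal.tendsto_toReal (measure_ne_top _ _)).comp ?_⟩
  have h1 : ∀ m, μ {ω | bulkDelay n arr svc m ω = j} = (busyLaw n μ arr svc Set.univ)⁻¹ *
      ∫⁻ x, busyLaw n μ arr svc {y | x + y = j} ∂waitingLaw n μ arr svc m := by
    intro m
    rw [← measure_bulkDelay hin hn hlam, ← mul_assoc, ENNReal.inv_mul_cancel hp hp', one_mul]
  simp_rw [h1]
  rw [Measure.smul_apply, Measure.map_apply (measurable_of_countable _) (measurableSet_singleton _),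
    Measure.prod_apply (Set.to_countable _).measurableSet, smul_eq_mul]
  refine ENNReal.Tendsto.const_mul ?_ (Or.inr (ENNReal.inv_ne_top.2 hp))
  refine tendsto_lintegral_of_finite_support hw (j + 1) (fun x hx => ?_) fun x => measure_ne_top _ _
  convert measure_empty (μ := busyLaw n μ arr svc)
  ext y
  simp only [Set.mem_ofPred_eq, Set.mem_empty_iff_false, iff_false]
  omega

theorem theorem1 {𝒳 𝒴 : Type*} [MeasurableSpace 𝒳] [MeasurableSpace 𝒴]
    (κ : Kernel 𝒳 𝒴) [IsMarkovKernel κ]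
    (n k : ℕ) (hn : 0 < n) (Pτ : Measure ℕ) (ε : ℝ) (C : VLSFCode κ n k Pτ ε)
    {Ω : Type*} [MeasurableSpace Ω] (μ : Measure Ω) [IsProbabilityMeasure μ]
    (lam : ℝ) (hlam : 0 < lam) (arr : ℕ → Ω → Bool) (svc : ℕ → ℕ → Ω → ℕ)
    (hin : IsQueueInput μ lam Pτ arr svc)
    (hint : Integrable (fun x : ℕ => (x : ℝ)) Pτ)
    (hstab : lam * n * lawMean Pτ < 1) :
    (∃ D : Measure ℕ, IsSteadyStateLaw μ (bulkDelay n arr svc) D) ∧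
    ∀ D : Measure ℕ, IsSteadyStateLaw μ (bulkDelay n arr svc) D →
      ∀ s : ℂ, ‖s‖ ≤ 1 → s ≠ 1 →
        (1 - (1 - (lam : ℂ)) ^ n) * (s - (1 - lam + lam * lawPGF Pτ s) ^ n) ≠ 0 ∧
        lawPGF D s =
          (1 - (lam : ℂ) * n * lawMean Pτ) *
            (((1 - s) * ((1 - (lam : ℂ)) ^ n - (1 - lam + lam * lawPGF Pτ s) ^ n)) /
              ((1 - (1 - (lam : ℂ)) ^ n) * (s - (1 - lam + lam * lawPGF Pτ s) ^ n))) := by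
  have hlam1 : lam ≤ 1 := by
    rw [← hin.prob_arr 0]
    exact measureReal_le_one
  have hPτ : IsProbabilityMeasure Pτ := by
    rw [← hin.law_svc 0 0]
    exact Measure.isProbabilityMeasure_map (hin.measurable_svc 0 0).aemeasurable
  have hprob : ∀ m, IsProbabilityMeasure (waitingLaw n μ arr svc m) := fun m =>
    Measure.isProbabilityMeasure_map (aemeasurable_bulkWaiting hin hn hlam m)
  have hp := busyLaw_univ_ne_zero hin hn hlam
  have hp' := measure_ne_top (busyLaw n μ arr svc) Set.univ
  have hqp := idleProb_add_busyLaw (n := n) hin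
  have hlim : Tendsto (fun r : ℝ => ((idleProb n μ arr).toReal +
      ∫ x, r ^ x ∂busyLaw n μ arr svc - r) / (1 - r)) (𝓝[<] 1) (𝓝 (1 - lam * n * lawMean Pτ)) := by
    refine (tendsto_compound_sub_div hint lam n).congr' ?_
    have hev : ∀ᶠ r : ℝ in 𝓝[<] 1, r ∈ Set.Ioo 0 1 := Ioo_mem_nhdsLT (by norm_num)
    filter_upwards [hev] with r hr
    have hr1 : ‖r‖ ≤ 1 := by
      rw [Real.norm_eq_abs, abs_of_pos hr.1]
      exact hr.2.le
    have := idleProb_add_pgf_busyLaw (n := n) hin hr1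
    simp only [RCLike.ofReal_real_eq_id, id] at this
    rw [this]
  obtain ⟨w, hw1, hw, hpgf⟩ := exists_stationary_waiting hqp hp waitingLaw_zero
    (isQueueStep_waitingLaw hin hn hlam) (sub_pos.2 hstab) hlim
  have hD := isSteadyStateLaw_bulkDelay hin hn hlam hw
  refine ⟨⟨_, hD⟩, fun D hD' s hs hs1 => ?_⟩
  rw [hD'.unique hD]
  have hA : ((1 - lam) ^ n : ℂ) + ∫ x, s ^ x ∂busyLaw n μ arr svc =
      (1 - lam + lam * lawPGF Pτ s) ^ n := by
    have h := idleProb_add_pgf_busyLaw (n := n) hin hs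
    rw [idleProb_toReal hin] at h
    simpa [lawPGF] using h
  have hW := hpgf s hs
  rw [idleProb_toReal hin] at hW
  push_cast at hW
  rw [hA] at hW
  have hpr : (busyLaw n μ arr svc).real Set.univ = 1 - (1 - lam) ^ n := by
    have h := congrArg ENNReal.toReal hqp
    rw [ENNReal.toReal_add (show idleProb n μ arr ≠ ⊤ from measure_ne_top _ _) hp', idleProb_toReal hin, ENNReal.toReal_one] at h
    rw [measureReal_def]
    linarith
  have hpr0 : (busyLaw n μ arr svc).real Set.univ ≠ 0 := (ENNReal.toReal_ne_zero).2 ⟨hp, hp'⟩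
  have hpc : (1 - (1 - (lam : ℂ)) ^ n) ≠ 0 := by
    rw [hpr] at hpr0
    exact_mod_cast hpr0
  -- A zero would make s a fixed point of A, and the Lipschitz bound would give |1 − s| ≤ ρ|1 − s|
  -- with load ρ < 1.
  have hden : s - (1 - lam + lam * lawPGF Pτ s) ^ n ≠ 0 := by
    intro h0
    have h := norm_one_sub_compound_le hint hlam.le hlam1 n hs
    have h2 : (1 - lam + lam * ∫ x, s ^ x ∂Pτ : ℂ) ^ n = s := (sub_eq_zero.1 h0).symm
    rw [h2] at h
    have h3 : 0 < ‖1 - s‖ := norm_pos_iff.2 (sub_ne_zero.2 hs1.symm)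
    nlinarith
  refine ⟨mul_ne_zero hpc hden, ?_⟩
  have hPD : lawPGF ((busyLaw n μ arr svc Set.univ)⁻¹ •
      (w.prod (busyLaw n μ arr svc)).map fun p => p.1 + p.2) s =
      (1 - (1 - (lam : ℂ)) ^ n)⁻¹ * ((∫ x, s ^ x ∂w) * ∫ x, s ^ x ∂busyLaw n μ arr svc) := by
    rw [lawPGF, integral_smul_measure, integral_map (measurable_of_countable _).aemeasurable
      (measurable_of_countable _).aestronglyMeasurable, integral_pow_add, ENNReal.toReal_inv,
      ← measureReal_def, hpr, Complex.real_smul]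
    push_cast
    rfl
  rw [hPD, ← mul_div_assoc, eq_div_iff (mul_ne_zero hpc hden), ← hA]
  rw [← hA] at hW
  field_simp
  -- The delay has generating function W·P/(1 − q) with P = A − q; multiplying the
  -- Pollaczek–Khinchine equation by −P matches the signs in the stated quotient.
  linear_combination (-∫ x, s ^ x ∂busyLaw n μ arr svc) * hW
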